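/- **Setting.** Let $F:\mathbb R^n\times\Xi\to\mathbb R$, $c_E:\mathbb R^n\to\mathbb R^{m_E}$, $c_I:\mathbb R^n\to\mathbb R^{m_I}$. For a nonempty finite batch $S$ of samples put $F_S(x)=\frac1{|S|}\sum_{\xi\in S}F(x,\xi)$ and $g_S(x)=\frac1{|S|}\sum_{\xi\in S}\nabla F(x,\xi)$. Fix $\|\cdot\|_\bullet$ to be either $\|\cdot\|_\infty$ or $\|\cdot\|_1$, and let $V(x)=\|(c_E(x),[c_I(x)]_+)\|_\bullet$ be the constraint violation. Unmarked norms are Euclidean. **Algorithm (inequality-constrained RA-SQP).** Inputs: $\gamma_k\in[0,1)$, $\epsilon_k\ge 0$, $\bar\tau>0$, $\epsilon_\sigma,\epsilon_\tau,\epsilon_\alpha,\eta\in(0,1)$, $0<\sigma_p<\sigma_d<\infty$, batches $S_0,S_1,\dots$, and $x_{0,0}$. For each $k=0,1,\dots$ set $\tau_{k,-1}=\bar\tau$ and repeat for $j=0,1,\dots$, writing $x=x_{k,j}$, $g=g_{S_k}(x)$: 1. Let $(p_{k,j},y)$ be a solution of the linear program that minimizes $t(y)$ subject to $-y_E\le c_E(x)+\nabla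 c_E(x)^Tp\le y_E$, $c_I(x)+\nabla c_I(x)^Tp\le y_I$, $y\ge0$, $\|p\|_\bullet\le\sigma_p$. For $\|\cdot\|_\infty$, $y$ is a scalar, $y_E=ye$, $y_I=ye$ and $t(y)=y$; for $\|\cdot\|_1$, $y=(y_E,y_I)$ and $t(y)=e^Ty_E+e^Ty_I$. 2. If $p_{k,j}=0$ and $y\ne0$, stop the algorithm and return $x_{k,j}$ as an infeasible stationary point. 3. Choose a matrix $H_{k,j}$, and let $d_{k,j}$ minimize $g^Td+\frac12d^TH_{k,j}d$ subject to $-y_E\le c_E(x)+\nabla c_E(x)^Td\le y_E$, $c_I(x)+\nabla c_I(x)^Td\le y_I$, $\|d\|_\bullet\le\sigma_d$. 4. If $\|d_{k,j}\|\le\gamma_k\|d_{k,0}\|+\epsilon_k$ (the termination test), set $N_k=j$, $x_{k+1,0}=x_{k,N_k}$ and go to the next $k$. 5. With $\Delta_c=V(x)-t(y)$, let $\tau^{trial}=\infty$ if $g^Td_{k,j}+d_{k,j}^TH_{k,j}d_{k,j}\le0$ and $\tau^{trial}=\frac{(1-\epsilon_\sigma)\Delta_c}{g^Td_{k,j}+d_{k,j}^TH_{k,j}d_{k,j}}$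 otherwise. Put $\tau_{k,j}=\tau_{k,j-1}$ if $\tau_{k,j-1}\le\tau^{trial}$, and $\tau_{k,j}=\min\{(1-\epsilon_\tau)\tau_{k,j-1},\tau^{trial}\}$ otherwise. 6. Let $\alpha_{k,j}$ be the first $\alpha\in\{1,\epsilon_\alpha,\epsilon_\alpha^2,\dots\}$ with $\phi(x+\alpha d_{k,j})\le\phi(x)-\eta\alpha\,(-\tau_{k,j}g^Td_{k,j}+\Delta_c)$, where $\phi(z)=\tau_{k,j}F_{S_k}(z)+V(z)$, and set $x_{k,j+1}=x_{k,j}+\alpha_{k,j}d_{k,j}$. **Assumptions.** Fix any run of the algorithm (any sample realization, any choice among solutions of the subproblems). There is a closed bounded convex set $\chi\subset\mathbb R^n$ that contains all its iterates. $F(\cdot,\xi)$ is differentiable for each sampled $\xi$; each $F_{S_k}$ is continuously differentiable on $\mathbb R^n$ with gradient Lipschitz on $\chi$; $c_E$ and $c_I$ are continuously differentiable on $\mathbb R^n$ with Jacobians Lipschitz on $\chi$. There are $\kappa_H\ge\mu_H>0$ such that all $H_{k,j}$ are symmetric with $\mu_HI\preceq H_{k,j}\preceq\kappa_HI$. The extended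 MFCQ holds at every $x\in\chi$: $\nabla c_E(x)^T$ has full row rank $m_E$, and there is $u\in\mathbb R^n$ with $\nabla c_E(x)^Tu=0$ and $[\nabla c_I(x)^Tu]_i>0$ for all $i$ with $[c_I(x)]_i\ge0$ (replacing $u$ by $-u$, one may equivalently ask for $<0$). **Theorem.** For each outer iteration $k\ge0$ that the run reaches: (a) Run the inner loop from $x_{k,0}$ with the termination test of step 4 left out, with matrices that satisfy the same bounds and iterates in $\chi$. Then either it stops after finitely many iterations in step 2, at an infeasible stationary point, or all its iterations, including their line searches, are well defined and $d_{k,j}\to0$ as $j\to\infty$. (b) If $\gamma_k>0$ or $\epsilon_k>0$, then the inner loop of the algorithm, including its line searches, terminates finitely: either in step 2 at an infeasible stationary point, or because the termination test of step 4 is satisfied. Here an infeasible stationary point is a point $x$ that violates the constraints and at which all one-sided directional derivatives of $V$ exist and are nonnegative. -/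

import Mathlib

open Filter Topology
open scoped Matrix

noncomputable section

namespace RASQP

/-- `ℝⁿ` with the Euclidean norm. -/
abbrev Vec (n : ℕ) : Type := EuclideanSpace ℝ (Fin n)

/-- The norm in which the constraint violation is measured (and the directions are bounded). -/
inductive NormChoice where
  | linf
  | l1

/-- The `ℓ∞` norm or the `ℓ1` norm of a finite real vector. -/
def vnorm {ι : Type} [Fintype ι] : NormChoice → (ι → ℝ) → ℝ
  | .linf, v => ‖v‖
  | .l1, v => ∑ i, |v i|

/-- Stochastic objective `F(x, ξ)` and deterministic constraints `cE(x) = 0`, `cI(x) ≤ 0`. -/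
structure Problem (n mE mI : ℕ) (Ξ : Type*) where
  F : Vec n → Ξ → ℝ
  cE : Vec n → Vec mE
  cI : Vec n → Vec mI

/-- A nonempty finite batch of samples (repetitions are allowed, as for i.i.d. draws). -/
structure SampleSet (Ξ : Type*) where
  size : ℕ
  size_pos : 0 < size
  sample : Fin size → Ξ

/-- The user-defined parameters. -/
structure Params where
  (γ ε : ℕ → ℝ)
  (τbar εσ ετ εα η σp σd : ℝ)
  γ_nonneg : ∀ k, 0 ≤ γ k
  γ_lt_one : ∀ k, γ k < 1
  ε_nonneg : ∀ k, 0 ≤ ε k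
  τbar_pos : 0 < τbar
  εσ_mem : εσ ∈ Set.Ioo (0 : ℝ) 1
  ετ_mem : ετ ∈ Set.Ioo (0 : ℝ) 1
  εα_mem : εα ∈ Set.Ioo (0 : ℝ) 1
  η_mem : η ∈ Set.Ioo (0 : ℝ) 1
  σp_pos : 0 < σp
  σp_lt_σd : σp < σd

/-- The slack variables: a scalar `y` for `ℓ∞`, a pair `(y_E, y_I)` of vectors for `ℓ1`. -/
def Slack (mE mI : ℕ) : NormChoice → Type
  | .linf => ℝ
  | .l1 => (Fin mE → ℝ) × (Fin mI → ℝ)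

namespace Slack

variable {mE mI : ℕ}

/-- Slack of the `i`-th equality constraint. -/
def eq : (q : NormChoice) → Slack mE mI q → Fin mE → ℝ
  | .linf, y => fun _ => y
  | .l1, y => y.1

/-- Slack of the `i`-th inequality constraint. -/
def ineq : (q : NormChoice) → Slack mE mI q → Fin mI → ℝ
  | .linf, y => fun _ => y
  | .l1, y => y.2

/-- The objective of the linear program: `y`, respectively `eᵀ y_E + eᵀ y_I`. -/
def total : (q : NormChoice) → Slack mE mI q → ℝ
  | .linf, y => y
  | .l1, y => ∑ i, y.1 i + ∑ i, y.2 i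

def Nonneg : (q : NormChoice) → Slack mE mI q → Prop
  | .linf, y => (0 : ℝ) ≤ y
  | .l1, y => (∀ i, 0 ≤ y.1 i) ∧ (∀ i, 0 ≤ y.2 i)

/-- `y > 0`, respectively `‖y_E‖ > 0` or `‖y_I‖ > 0`. -/
def Violated : (q : NormChoice) → Slack mE mI q → Prop
  | .linf, y => (0 : ℝ) < y
  | .l1, y => 0 < ‖y.1‖ ∨ 0 < ‖y.2‖

end Slack

/-- Subsampled objective `F_S`. -/
def objS {n mE mI : ℕ} {Ξ : Type*} (P : Problem n mE mI Ξ) (S : SampleSet Ξ) (x : Vec n) : ℝ :=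
  (1 / (S.size : ℝ)) * ∑ i, P.F x (S.sample i)

/-- Subsampled gradient `g_S`. -/
def gradS {n mE mI : ℕ} {Ξ : Type*} (P : Problem n mE mI Ξ) (S : SampleSet Ξ) (x : Vec n) :
    Vec n :=
  (1 / (S.size : ℝ)) • ∑ i, gradient (fun z => P.F z (S.sample i)) x

/-- Constraint violation: the norm of the stacked vector `(cE(x), [cI(x)]₊)`. -/
def violation {n mE mI : ℕ} {Ξ : Type*} (P : Problem n mE mI Ξ) (q : NormChoice) (x : Vec n) : ℝ :=
  vnorm q (Sum.elim (fun i => P.cE x i) (fun i => max (P.cI x i) 0) : Fin mE ⊕ Fin mI → ℝ)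

/-- The linearized constraints at `x` hold in the direction `p` up to the slack `y`. -/
def LinFeasible {n mE mI : ℕ} {Ξ : Type*} (P : Problem n mE mI Ξ) (q : NormChoice) (x p : Vec n)
    (y : Slack mE mI q) : Prop :=
  (∀ i, -(Slack.eq q y i) ≤ P.cE x i + (fderiv ℝ P.cE x p) i) ∧
  (∀ i, P.cE x i + (fderiv ℝ P.cE x p) i ≤ Slack.eq q y i) ∧
  (∀ i, P.cI x i + (fderiv ℝ P.cI x p) i ≤ Slack.ineq q y i)

/-- `(p, y)` is feasible for the linear program that minimizes the linearized violation. -/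
def LPFeasible {n mE mI : ℕ} {Ξ : Type*} (P : Problem n mE mI Ξ) (q : NormChoice) (σp : ℝ)
    (x p : Vec n) (y : Slack mE mI q) : Prop :=
  LinFeasible P q x p y ∧ Slack.Nonneg q y ∧ vnorm q (fun i => p i) ≤ σp

/-- `(p, y)` is a global solution of that linear program. -/
def SolvesLP {n mE mI : ℕ} {Ξ : Type*} (P : Problem n mE mI Ξ) (q : NormChoice) (σp : ℝ)
    (x p : Vec n) (y : Slack mE mI q) : Prop :=
  LPFeasible P q σp x p y ∧
    ∀ p' y', LPFeasible P q σp x p' y' → Slack.total q y ≤ Slack.total q y'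

/-- `dᵀ H d`. -/
def quad {n : ℕ} (H : Matrix (Fin n) (Fin n) ℝ) (d : Vec n) : ℝ :=
  (fun i => d i) ⬝ᵥ (H *ᵥ (fun i => d i))

/-- `d` is feasible for the quadratic program with slack `y`. -/
def QPFeasible {n mE mI : ℕ} {Ξ : Type*} (P : Problem n mE mI Ξ) (q : NormChoice) (σd : ℝ)
    (x : Vec n) (y : Slack mE mI q) (d : Vec n) : Prop :=
  LinFeasible P q x d y ∧ vnorm q (fun i => d i) ≤ σd

/-- `d` is a global solution of the quadratic program with gradient `g` and matrix `H`. -/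
def SolvesQP {n mE mI : ℕ} {Ξ : Type*} (P : Problem n mE mI Ξ) (q : NormChoice) (σd : ℝ)
    (x : Vec n) (y : Slack mE mI q) (g : Vec n) (H : Matrix (Fin n) (Fin n) ℝ) (d : Vec n) : Prop :=
  QPFeasible P q σd x y d ∧
    ∀ d', QPFeasible P q σd x y d' →
      inner ℝ g d + 1 / 2 * quad H d ≤ inner ℝ g d' + 1 / 2 * quad H d'

/-- Merit function `φ_S(x, τ)`. -/
def merit {n mE mI : ℕ} {Ξ : Type*} (P : Problem n mE mI Ξ) (q : NormChoice) (S : SampleSet Ξ)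
    (x : Vec n) (τ : ℝ) : ℝ :=
  τ * objS P S x + violation P q x

/-- Improvement `Δ_c` in the linearized constraint violation. -/
def deltaC {n mE mI : ℕ} {Ξ : Type*} (P : Problem n mE mI Ξ) (q : NormChoice) (x : Vec n)
    (y : Slack mE mI q) : ℝ :=
  violation P q x - Slack.total q y

/-- Predicted reduction `Δl_S(x, d, τ)` of the linear model of the merit function. -/
def deltaL {n mE mI : ℕ} {Ξ : Type*} (P : Problem n mE mI Ξ) (q : NormChoice) (S : SampleSet Ξ)
    (x : Vec n) (y : Slack mE mI q) (d : Vec n) (τ : ℝ) : ℝ :=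
  -τ * inner ℝ (gradS P S x) d + deltaC P q x y

open Classical in
/-- Merit parameter update. The trial value is `+∞` when `gᵀd + dᵀHd ≤ 0`, and
`(1 - εσ) Δ_c / (gᵀd + dᵀHd)` otherwise; `τ` is kept when it does not exceed the trial value. -/
def updateTau (A : Params) (gd dHd Δc τ : ℝ) : ℝ :=
  if gd + dHd ≤ 0 ∨ τ ≤ (1 - A.εσ) * Δc / (gd + dHd) then τ
  else min ((1 - A.ετ) * τ) ((1 - A.εσ) * Δc / (gd + dHd))

/-- The quantities of one inner loop, indexed by the inner iteration `j`. Here `tau j` is the merit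
parameter on entering iteration `j` (so `τ_{k,j} = tau (j + 1)` and `τ_{k,-1} = tau 0`). -/
structure InnerData (n mE mI : ℕ) (q : NormChoice) where
  x : ℕ → Vec n
  p : ℕ → Vec n
  y : ℕ → Slack mE mI q
  H : ℕ → Matrix (Fin n) (Fin n) ℝ
  d : ℕ → Vec n
  tau : ℕ → ℝ

section InnerLoop

variable {n mE mI : ℕ} {Ξ : Type*} {q : NormChoice}

/-- The check for an infeasible stationary point succeeds at inner iteration `j`. -/
def InfStop (D : InnerData n mE mI q) (j : ℕ) : Prop :=
  ‖D.p j‖ = 0 ∧ Slack.Violated q (D.y j)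

/-- Sufficient decrease at inner iteration `j` with the step size `εα ^ i`. -/
def Armijo (P : Problem n mE mI Ξ) (A : Params) (S : SampleSet Ξ) (D : InnerData n mE mI q)
    (j i : ℕ) : Prop :=
  merit P q S (D.x j + A.εα ^ i • D.d j) (D.tau (j + 1)) ≤
    merit P q S (D.x j) (D.tau (j + 1)) -
      A.η * A.εα ^ i * deltaL P q S (D.x j) (D.y j) (D.d j) (D.tau (j + 1))

/-- The inner iteration `j` is reached: none of the previous iterations stopped, by the
infeasibility check or by the test `T`, and each of their backtracking line searches was finite. -/
inductive Reached (P : Problem n mE mI Ξ) (A : Params) (S : SampleSet Ξ) (T : ℕ → Prop)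
    (D : InnerData n mE mI q) : ℕ → Prop
  | zero : Reached P A S T D 0
  | succ (j : ℕ) : Reached P A S T D j → ¬ InfStop D j → ¬ T j → (∃ i, Armijo P A S D j i) →
      Reached P A S T D (j + 1)

/-- `D` is generated by the inner loop on the batch `S`, started at `x₀`, with stopping test `T`.
Nothing is required of entries of `D` that the loop does not compute. -/
structure IsInnerLoop (P : Problem n mE mI Ξ) (A : Params) (S : SampleSet Ξ) (T : ℕ → Prop)
    (x₀ : Vec n) (D : InnerData n mE mI q) : Prop where
  x_zero : D.x 0 = x₀
  tau_zero : D.tau 0 = A.τbar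
  solvesLP : ∀ j, Reached P A S T D j → SolvesLP P q A.σp (D.x j) (D.p j) (D.y j)
  solvesQP : ∀ j, Reached P A S T D j → ¬ InfStop D j →
    SolvesQP P q A.σd (D.x j) (D.y j) (gradS P S (D.x j)) (D.H j) (D.d j)
  tau_succ : ∀ j, Reached P A S T D j → ¬ InfStop D j → ¬ T j →
    D.tau (j + 1) = updateTau A (inner ℝ (gradS P S (D.x j)) (D.d j)) (quad (D.H j) (D.d j))
      (deltaC P q (D.x j) (D.y j)) (D.tau j)
  x_succ : ∀ j, Reached P A S T D j → ¬ InfStop D j → ¬ T j →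
    ∀ i, IsLeast {i | Armijo P A S D j i} i → D.x (j + 1) = D.x j + A.εα ^ i • D.d j

/-- `H` is symmetric and `μ I ⪯ H ⪯ κ I`, for every matrix used in the inner loop. -/
def HessianBounds (P : Problem n mE mI Ξ) (A : Params) (S : SampleSet Ξ) (T : ℕ → Prop)
    (μ κ : ℝ) (D : InnerData n mE mI q) : Prop :=
  ∀ j, Reached P A S T D j → ¬ InfStop D j →
    (D.H j).IsSymm ∧ (D.H j - μ • (1 : Matrix (Fin n) (Fin n) ℝ)).PosSemidef ∧
      (κ • (1 : Matrix (Fin n) (Fin n) ℝ) - D.H j).PosSemidef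

/-- Direction-norm termination test of outer iteration `k`. -/
def DirTest (A : Params) (k : ℕ) (D : InnerData n mE mI q) (j : ℕ) : Prop :=
  ‖D.d j‖ ≤ A.γ k * ‖D.d 0‖ + A.ε k

/-- The inner loop `k` ends at iteration `N` because the direction-norm test is satisfied. -/
def EndsByTest (P : Problem n mE mI Ξ) (A : Params) (S : SampleSet Ξ) (k : ℕ)
    (D : InnerData n mE mI q) (N : ℕ) : Prop :=
  Reached P A S (DirTest A k D) D N ∧ ¬ InfStop D N ∧ DirTest A k D N

end InnerLoop

section OuterLoop

variable {n mE mI : ℕ} {Ξ : Type*} {q : NormChoice}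

/-- The outer iteration `k` is reached: all earlier inner loops ended by the test. -/
def OuterReached (P : Problem n mE mI Ξ) (A : Params) (S : ℕ → SampleSet Ξ)
    (D : ℕ → InnerData n mE mI q) (k : ℕ) : Prop :=
  ∀ l < k, ∃ N, EndsByTest P A (S l) l (D l) N

/-- `D` is a run of the algorithm from `x₀` with the batches `S 0, S 1, …`. -/
structure IsRun (P : Problem n mE mI Ξ) (A : Params) (S : ℕ → SampleSet Ξ) (x₀ : Vec n)
    (D : ℕ → InnerData n mE mI q) : Prop where
  start : (D 0).x 0 = x₀
  inner_loop : ∀ k, OuterReached P A S D k →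
    IsInnerLoop P A (S k) (DirTest A k (D k)) ((D k).x 0) (D k)
  restart : ∀ k, OuterReached P A S D k → ∀ N, EndsByTest P A (S k) k (D k) N →
    (D (k + 1)).x 0 = (D k).x N

end OuterLoop

section Assumptions

variable {n mE mI : ℕ} {Ξ : Type*}

/-- Smoothness of the subsampled objectives and of the constraints. -/
structure Smooth (P : Problem n mE mI Ξ) (S : ℕ → SampleSet Ξ) (χ : Set (Vec n)) : Prop where
  differentiable_F : ∀ k i, Differentiable ℝ (fun z => P.F z ((S k).sample i))
  contDiff_objS : ∀ k, ContDiff ℝ 1 (objS P (S k))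
  lipschitz_grad : ∀ k, ∃ L, LipschitzOnWith L (gradient (objS P (S k))) χ
  contDiff_cE : ContDiff ℝ 1 P.cE
  contDiff_cI : ContDiff ℝ 1 P.cI
  lipschitz_cE : ∃ L, LipschitzOnWith L (fderiv ℝ P.cE) χ
  lipschitz_cI : ∃ L, LipschitzOnWith L (fderiv ℝ P.cI) χ

/-- Extended MFCQ on `χ`: full row rank of the Jacobian of `cE`, and a direction `u` in its kernel
that is strictly monotone for all inequalities that are active or violated. As `u` may be replaced
by `-u`, the sign in the second condition is immaterial. -/
def ExtendedMFCQ (P : Problem n mE mI Ξ) (χ : Set (Vec n)) : Prop :=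
  ∀ x ∈ χ, Function.Surjective (fderiv ℝ P.cE x) ∧
    ∃ u : Vec n, fderiv ℝ P.cE x u = 0 ∧ ∀ i, 0 ≤ P.cI x i → 0 < (fderiv ℝ P.cI x u) i

/-- `x` is infeasible and is a stationary point of the constraint violation: all its one-sided
directional derivatives at `x` exist and are nonnegative. -/
def IsInfeasibleStationary (P : Problem n mE mI Ξ) (q : NormChoice) (x : Vec n) : Prop :=
  ¬ (P.cE x = 0 ∧ ∀ i, P.cI x i ≤ 0) ∧
    ∀ v : Vec n, ∃ L : ℝ, 0 ≤ L ∧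
      HasDerivWithinAt (fun t : ℝ => violation P q (x + t • v)) L (Set.Ici 0) 0

end Assumptions

end RASQP

end

/-! The inner loop is a descent method for the merit function, and everything rests on keeping the
merit parameter away from zero. By compactness, the extended MFCQ yields one constant `C` such that
the quadratic program at any point of `χ` has a feasible `d'` with `‖d'‖ ≤ C Δ_c`
(`exists_qpFeasible_norm_le`). Testing first-order optimality of `d` against `d'` gives `gᵀd + dᵀHd
≤ C' Δ_c` (`exists_inner_add_quad_le`), so every finite trial value is at least `(1 - εσ) / C'`, and
`τ` stays above some `τm > 0` (`updateTau_spec`). The update rule then makes the predicted reduction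
at least `τm μ ‖d‖²`.

The model error is `o(α)` uniformly on the compact set `χ`, so while `‖d‖ ≥ δ` the line search
accepts every step below a threshold depending only on `δ` (`exists_uniform_step`). Each such
iteration lowers a bounded-below Lyapunov function by a fixed amount; hence `d_j → 0` unless the
loop stops (`IsInnerLoop.alternative`).

A stop in step 2 is legitimate because `p = 0` being optimal makes `0` a local minimizer of the
convex linearized violation, which has the same one-sided derivatives as `V`
(`isInfeasibleStationary_of_solvesLP`). -/

namespace RASQP

/-! ### Both norms treated at once: monotonicity, convexity and Lipschitz bounds for `‖(a, [b]₊)‖`.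
-/

section StackedNorm

variable {ι : Type} [Fintype ι]

theorem vnorm_nonneg (q : NormChoice) (v : ι → ℝ) : 0 ≤ vnorm q v := by
  cases q with
  | linf => exact norm_nonneg _
  | l1 => exact Finset.sum_nonneg fun _ _ => abs_nonneg _

theorem abs_le_vnorm (q : NormChoice) (v : ι → ℝ) (i : ι) : |v i| ≤ vnorm q v := by
  cases q with
  | linf => exact norm_le_pi_norm v i
  | l1 =>
    exact Finset.single_le_sum (f := fun i => |v i|) (fun _ _ => abs_nonneg _) (Finset.mem_univ i)

theorem vnorm_le_sum_abs (q : NormChoice) (v : ι → ℝ) : vnorm q v ≤ ∑ i, |v i| := by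
  cases q with
  | linf =>
    exact (pi_norm_le_iff_of_nonneg (Finset.sum_nonneg fun _ _ => abs_nonneg _)).2
      (abs_le_vnorm .l1 v)
  | l1 => exact le_rfl

theorem vnorm_mono (q : NormChoice) {v w : ι → ℝ} (h : ∀ i, |v i| ≤ w i) :
    vnorm q v ≤ vnorm q w := by
  cases q with
  | linf =>
    exact (pi_norm_le_iff_of_nonneg (norm_nonneg w)).2 fun i =>
      (h i).trans ((le_abs_self _).trans (norm_le_pi_norm w i))
  | l1 => exact Finset.sum_le_sum fun i _ => (h i).trans (le_abs_self _)

theorem vnorm_add_le (q : NormChoice) (v w : ι → ℝ) :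
    vnorm q (v + w) ≤ vnorm q v + vnorm q w := by
  cases q with
  | linf => exact norm_add_le v w
  | l1 =>
    exact (Finset.sum_le_sum fun i _ => abs_add_le (v i) (w i)).trans_eq Finset.sum_add_distrib

theorem vnorm_smul (q : NormChoice) (c : ℝ) (v : ι → ℝ) :
    vnorm q (c • v) = |c| * vnorm q v := by
  cases q with
  | linf => exact norm_smul c v
  | l1 => simp [vnorm, abs_mul, Finset.mul_sum]

theorem vnorm_abs (q : NormChoice) (v : ι → ℝ) : vnorm q (fun i => |v i|) = vnorm q v := by
  cases q with
  | linf => simp [vnorm, Pi.norm_def]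
  | l1 => simp [vnorm]

theorem vnorm_le_card_mul_norm (q : NormChoice) {n : ℕ} (v : Vec n) :
    vnorm q (fun i => v i) ≤ n * ‖v‖ := by
  refine (vnorm_le_sum_abs q _).trans ?_
  refine (Finset.sum_le_card_nsmul _ _ ‖v‖ fun i _ => PiLp.norm_apply_le v i).trans ?_
  simp

theorem norm_le_card_mul_of_abs_le {n : ℕ} {v : Vec n} {c : ℝ} (h : ∀ i, |v i| ≤ c) :
    ‖v‖ ≤ n * c := by
  have h1 : ‖v‖ ≤ ∑ i, |v i| := by
    rw [EuclideanSpace.norm_eq]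
    refine Real.sqrt_le_iff.2 ⟨Finset.sum_nonneg fun _ _ => abs_nonneg _, ?_⟩
    simpa using Finset.sum_sq_le_sq_sum_of_nonneg (s := Finset.univ) (f := fun i => |v i|)
      fun _ _ => abs_nonneg _
  refine h1.trans ((Finset.sum_le_card_nsmul _ _ c fun i _ => h i).trans ?_)
  simp

theorem norm_le_card_mul_vnorm (q : NormChoice) {n : ℕ} (v : Vec n) :
    ‖v‖ ≤ n * vnorm q (fun i => v i) :=
  norm_le_card_mul_of_abs_le fun i => abs_le_vnorm q (fun i => v i) i

/-- The norm of the stacked vector `(a, [b]₊)`. -/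
noncomputable def stackNorm {mE mI : ℕ} (q : NormChoice) (a : Vec mE) (b : Vec mI) : ℝ :=
  vnorm q (Sum.elim (fun i => a i) (fun i => max (b i) 0) : Fin mE ⊕ Fin mI → ℝ)

variable {mE mI : ℕ}

theorem stackNorm_nonneg (q : NormChoice) (a : Vec mE) (b : Vec mI) : 0 ≤ stackNorm q a b :=
  vnorm_nonneg q _

theorem abs_le_stackNorm (q : NormChoice) (a : Vec mE) (b : Vec mI) (i : Fin mE) :
    |a i| ≤ stackNorm q a b :=
  abs_le_vnorm q (Sum.elim (fun i => a i) (fun i => max (b i) 0)) (Sum.inl i)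

theorem le_stackNorm (q : NormChoice) (a : Vec mE) (b : Vec mI) (i : Fin mI) :
    b i ≤ stackNorm q a b :=
  (le_max_left _ _).trans <| (le_abs_self _).trans <|
    abs_le_vnorm q (Sum.elim (fun i => a i) (fun i => max (b i) 0)) (Sum.inr i)

/-- An upper bound on `b'` suffices because the positive part discards negative entries. -/
theorem stackNorm_le_mul (q : NormChoice) {a a' : Vec mE} {b b' : Vec mI} {c : ℝ} (hc : 0 ≤ c)
    (ha : ∀ i, |a' i| ≤ c * |a i|) (hb : ∀ i, b' i ≤ c * max (b i) 0) :
    stackNorm q a' b' ≤ c * stackNorm q a b := by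
  have h := vnorm_mono q
    (v := Sum.elim (fun i => a' i) (fun i => max (b' i) 0))
    (w := c • fun j => |(Sum.elim (fun i => a i) (fun i => max (b i) 0) : Fin mE ⊕ Fin mI → ℝ) j|)
    (by
      rintro (i | i)
      · simpa using ha i
      · have h0 : 0 ≤ c * max (b i) 0 := mul_nonneg hc (le_max_right _ _)
        simpa [abs_of_nonneg (le_max_right (b' i) 0), abs_of_nonneg (le_max_right (b i) 0)]
          using ⟨hb i, h0⟩)
  rwa [vnorm_smul, vnorm_abs, abs_of_nonneg hc] at h

theorem stackNorm_combo_le (q : NormChoice) (a a' : Vec mE) (b b' : Vec mI) {s t : ℝ}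
    (hs : 0 ≤ s) (ht : 0 ≤ t) :
    stackNorm q (s • a + t • a') (s • b + t • b') ≤
      s * stackNorm q a b + t * stackNorm q a' b' := by
  set u : Fin mE ⊕ Fin mI → ℝ := Sum.elim (fun i => a i) (fun i => max (b i) 0)
  set u' : Fin mE ⊕ Fin mI → ℝ := Sum.elim (fun i => a' i) (fun i => max (b' i) 0)
  have h := vnorm_mono q
    (v := Sum.elim (fun i => (s • a + t • a') i) (fun i => max ((s • b + t • b') i) 0))
    (w := (s • fun j => |u j|) + t • fun j => |u' j|)
    (by
      rintro (i | i)
      · have := abs_add_le (s * a i) (t * a' i)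
        simpa [u, u', abs_mul, abs_of_nonneg hs, abs_of_nonneg ht] using this
      · have h1 := mul_le_mul_of_nonneg_left (le_max_left (b i) 0) hs
        have h2 := mul_le_mul_of_nonneg_left (le_max_left (b' i) 0) ht
        have h3 := mul_nonneg hs (le_max_right (b i) 0)
        have h4 := mul_nonneg ht (le_max_right (b' i) 0)
        simp only [Sum.elim_inr, u, u', Pi.add_apply, Pi.smul_apply, smul_eq_mul, PiLp.add_apply,
          PiLp.smul_apply]
        rw [abs_of_nonneg (le_max_right _ _), abs_of_nonneg (le_max_right _ _),
          abs_of_nonneg (le_max_right _ _)]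
        exact max_le (by linarith) (by linarith))
  refine h.trans ((vnorm_add_le q _ _).trans_eq ?_)
  rw [vnorm_smul, vnorm_smul, vnorm_abs, vnorm_abs, abs_of_nonneg hs, abs_of_nonneg ht]
  rfl

theorem stackNorm_le_norm (q : NormChoice) (a : Vec mE) (b : Vec mI) :
    stackNorm q a b ≤ mE * ‖a‖ + mI * ‖b‖ := by
  refine (vnorm_le_sum_abs q _).trans ?_
  rw [Fintype.sum_sum_type]
  refine add_le_add ?_ ?_
  · exact (vnorm_le_card_mul_norm .l1 a)
  · refine (Finset.sum_le_card_nsmul _ _ ‖b‖ fun i _ => ?_).trans (by simp)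
    have h : |b i| ≤ ‖b‖ := PiLp.norm_apply_le b i
    simp only [Sum.elim_inr]
    rw [abs_of_nonneg (le_max_right _ _)]
    exact max_le ((le_abs_self _).trans h) (norm_nonneg _)

theorem stackNorm_le_add (q : NormChoice) (a a' : Vec mE) (b b' : Vec mI) :
    stackNorm q a' b' ≤ stackNorm q a b + (mE * ‖a' - a‖ + mI * ‖b' - b‖) := by
  have h := stackNorm_combo_le q a (a' - a) b (b' - b) zero_le_one zero_le_one
  have h2 := stackNorm_le_norm q (a' - a) (b' - b)
  simp only [one_smul, one_mul, add_sub_cancel] at h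
  linarith

end StackedNorm

/-! ### The linear program as minimization of the linearized violation. -/

section LinearProgram

variable {n mE mI : ℕ} {Ξ : Type*} {q : NormChoice}

/-- The violation of the constraints linearized at `x`, in the direction `p`. -/
noncomputable def linViolation (P : Problem n mE mI Ξ) (q : NormChoice) (x p : Vec n) : ℝ :=
  stackNorm q (P.cE x + fderiv ℝ P.cE x p) (P.cI x + fderiv ℝ P.cI x p)

theorem violation_eq_stackNorm (P : Problem n mE mI Ξ) (q : NormChoice) (x : Vec n) :
    violation P q x = stackNorm q (P.cE x) (P.cI x) := rfl

theorem linViolation_zero (P : Problem n mE mI Ξ) (q : NormChoice) (x : Vec n) :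
    linViolation P q x 0 = violation P q x := by
  simp [linViolation, violation_eq_stackNorm]

theorem linViolation_combo_le (P : Problem n mE mI Ξ) (q : NormChoice) (x p p' : Vec n) {s t : ℝ}
    (hs : 0 ≤ s) (ht : 0 ≤ t) (hst : s + t = 1) :
    linViolation P q x (s • p + t • p') ≤ s * linViolation P q x p + t * linViolation P q x p' := by
  have h := stackNorm_combo_le q (P.cE x + fderiv ℝ P.cE x p) (P.cE x + fderiv ℝ P.cE x p')
    (P.cI x + fderiv ℝ P.cI x p) (P.cI x + fderiv ℝ P.cI x p') hs ht
  refine le_of_eq_of_le ?_ h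
  unfold linViolation
  obtain rfl : s = 1 - t := by linarith
  congr 1 <;> simp only [map_add, map_smul] <;> module

theorem violation_eq_zero_iff (P : Problem n mE mI Ξ) (q : NormChoice) (x : Vec n) :
    violation P q x = 0 ↔ P.cE x = 0 ∧ ∀ i, P.cI x i ≤ 0 := by
  constructor
  · intro h
    refine ⟨?_, fun i => (le_stackNorm q (P.cE x) (P.cI x) i).trans_eq h⟩
    ext i
    exact abs_nonpos_iff.1 ((abs_le_stackNorm q (P.cE x) (P.cI x) i).trans_eq h)
  · rintro ⟨h1, h2⟩
    refine le_antisymm ?_ (vnorm_nonneg q _)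
    simpa [violation_eq_stackNorm] using stackNorm_le_mul q (a := P.cE x) (b := P.cI x) (c := 0) le_rfl
      (fun i => by simp [h1]) (fun i => by simpa using h2 i)

theorem linViolation_le_total (P : Problem n mE mI Ξ) (q : NormChoice) {x p : Vec n}
    {y : Slack mE mI q} (h : LinFeasible P q x p y) (hy : Slack.Nonneg q y) :
    linViolation P q x p ≤ Slack.total q y := by
  obtain ⟨h1, h2, h3⟩ := h
  cases q with
  | linf =>
    refine (pi_norm_le_iff_of_nonneg hy).2 ?_
    rintro (i | i)
    · exact abs_le.2 ⟨h1 i, h2 i⟩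
    · simp only [Sum.elim_inr, Real.norm_eq_abs]
      rw [abs_of_nonneg (le_max_right _ _)]
      exact max_le (h3 i) hy
  | l1 =>
    simp only [linViolation, stackNorm, vnorm, Fintype.sum_sum_type]
    refine add_le_add (Finset.sum_le_sum fun i _ => abs_le.2 ⟨h1 i, h2 i⟩)
      (Finset.sum_le_sum fun i _ => ?_)
    simp only [Sum.elim_inr]
    rw [abs_of_nonneg (le_max_right _ _)]
    exact max_le (h3 i) (hy.2 i)

/-- The tightest slack is the norm itself for `ℓ∞`, and the entrywise absolute values and positive
parts for `ℓ1`. With `linViolation_le_total` this eliminates the slack from the linear program. -/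
theorem exists_slack (P : Problem n mE mI Ξ) (q : NormChoice) (x p : Vec n) :
    ∃ y : Slack mE mI q, LinFeasible P q x p y ∧ Slack.Nonneg q y ∧
      Slack.total q y = linViolation P q x p := by
  cases q with
  | linf =>
    have h := abs_le_stackNorm .linf (P.cE x + fderiv ℝ P.cE x p) (P.cI x + fderiv ℝ P.cI x p)
    exact ⟨linViolation P .linf x p, ⟨fun i => (abs_le.1 (h i)).1, fun i => (abs_le.1 (h i)).2,
      le_stackNorm .linf (P.cE x + fderiv ℝ P.cE x p) (P.cI x + fderiv ℝ P.cI x p)⟩,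
      stackNorm_nonneg _ _ _, rfl⟩
  | l1 =>
    refine ⟨(fun i => |P.cE x i + fderiv ℝ P.cE x p i|,
      fun i => max (P.cI x i + fderiv ℝ P.cI x p i) 0),
      ⟨fun i => neg_abs_le _, fun i => le_abs_self _, fun i => le_max_left _ _⟩,
      ⟨fun i => abs_nonneg _, fun i => le_max_right _ _⟩, ?_⟩
    simp [linViolation, stackNorm, vnorm, Slack.total, abs_of_nonneg]

theorem SolvesLP.total_le {P : Problem n mE mI Ξ} {σp : ℝ} {x p : Vec n} {y : Slack mE mI q}
    (h : SolvesLP P q σp x p y) {p' : Vec n} (hp' : vnorm q (fun i => p' i) ≤ σp) :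
    Slack.total q y ≤ linViolation P q x p' := by
  obtain ⟨y', h1, h2, h3⟩ := exists_slack P q x p'
  exact (h.2 p' y' ⟨h1, h2, hp'⟩).trans_eq h3

theorem SolvesLP.total_le_violation {P : Problem n mE mI Ξ} {σp : ℝ} (hσ : 0 ≤ σp) {x p : Vec n}
    {y : Slack mE mI q} (h : SolvesLP P q σp x p y) : Slack.total q y ≤ violation P q x := by
  rw [← linViolation_zero]
  refine h.total_le ?_
  refine (vnorm_le_card_mul_norm q (0 : Vec n)).trans ?_
  simpa using hσ

theorem Slack.Violated.total_pos {y : Slack mE mI q} (h : Slack.Violated q y)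
    (hy : Slack.Nonneg q y) : 0 < Slack.total q y := by
  cases q with
  | linf => exact h
  | l1 =>
    have key : ∀ {m : ℕ} {v : Fin m → ℝ}, 0 < ‖v‖ → (∀ i, 0 ≤ v i) → 0 < ∑ i, v i := by
      intro m v hv h0
      obtain ⟨i, hi⟩ := Function.ne_iff.1 (norm_pos_iff.1 hv)
      exact Finset.sum_pos' (fun i _ => h0 i) ⟨i, Finset.mem_univ i, (h0 i).lt_of_ne' hi⟩
    rcases h with h | h
    · exact add_pos_of_pos_of_nonneg (key h hy.1) (Finset.sum_nonneg fun i _ => hy.2 i)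
    · exact add_pos_of_nonneg_of_pos (Finset.sum_nonneg fun i _ => hy.1 i) (key h hy.2)

end LinearProgram

/-! ### One-sided derivatives of the violation and infeasible stationary points. -/

section Stationarity

variable {n mE mI : ℕ} {Ξ : Type*} {q : NormChoice}

theorem convexOn_linViolation (P : Problem n mE mI Ξ) (q : NormChoice) (x v : Vec n) :
    ConvexOn ℝ Set.univ (fun t : ℝ => linViolation P q x (t • v)) := by
  refine ⟨convex_univ, fun a _ b _ s t hs ht hst => ?_⟩
  have h := linViolation_combo_le P q x (a • v) (b • v) hs ht hst
  simpa only [smul_eq_mul, add_smul, mul_smul] using h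

/-- The stacked norm is Lipschitz and the constraints differ from their linearizations by `o(t)`.
Thus one-sided derivatives can be computed on the linearized violation, where convexity makes them
exist. -/
theorem hasDerivAt_violation_sub_linViolation (P : Problem n mE mI Ξ) (q : NormChoice)
    {x : Vec n} (hE : DifferentiableAt ℝ P.cE x) (hI : DifferentiableAt ℝ P.cI x) (v : Vec n) :
    HasDerivAt (fun t : ℝ => violation P q (x + t • v) - linViolation P q x (t • v)) 0 0 := by
  have key : ∀ {m : ℕ} {c : Vec n → Vec m}, DifferentiableAt ℝ c x →
      (fun t : ℝ => c (x + t • v) - (c x + fderiv ℝ c x (t • v))) =o[𝓝 0] fun t : ℝ => t := by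
    intro m c hc
    have h1 : HasFDerivAt c (fderiv ℝ c x) (x + (0 : ℝ) • v) := by simpa using hc.hasFDerivAt
    have h2 : HasDerivAt (fun t : ℝ => x + t • v) ((1 : ℝ) • v) 0 :=
      ((hasDerivAt_id (0 : ℝ)).smul_const v).const_add x
    have h3 := (h1.comp_hasDerivAt (0 : ℝ) h2).isLittleO
    simpa [Function.comp_def, sub_sub] using h3
  have h := ((key hE).norm_left.const_mul_left (mE : ℝ)).add
    ((key hI).norm_left.const_mul_left (mI : ℝ))
  refine .of_isLittleO ?_
  refine (Asymptotics.IsBigO.of_bound 1 (Eventually.of_forall fun t => ?_)).trans_isLittleO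
    (by simpa only [sub_zero] using h)
  simp only [zero_smul, add_zero, linViolation_zero, sub_self, sub_zero, smul_zero, one_mul,
    Real.norm_eq_abs]
  have h1 := stackNorm_le_add q (P.cE x + fderiv ℝ P.cE x (t • v)) (P.cE (x + t • v))
    (P.cI x + fderiv ℝ P.cI x (t • v)) (P.cI (x + t • v))
  have h2 := stackNorm_le_add q (P.cE (x + t • v)) (P.cE x + fderiv ℝ P.cE x (t • v))
    (P.cI (x + t • v)) (P.cI x + fderiv ℝ P.cI x (t • v))
  rw [norm_sub_rev, norm_sub_rev (P.cI x + _)] at h2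
  rw [violation_eq_stackNorm, linViolation]
  refine (abs_le.2 ⟨?_, ?_⟩).trans (le_abs_self _) <;> linarith

theorem isInfeasibleStationary_of_solvesLP {P : Problem n mE mI Ξ} {σp : ℝ} (hσ : 0 < σp)
    {x p : Vec n} {y : Slack mE mI q} (hE : DifferentiableAt ℝ P.cE x)
    (hI : DifferentiableAt ℝ P.cI x) (h : SolvesLP P q σp x p y) (hp : p = 0)
    (hy : Slack.Violated q y) : IsInfeasibleStationary P q x := by
  subst hp
  have hV : violation P q x ≤ Slack.total q y := by
    rw [← linViolation_zero]
    exact linViolation_le_total P q h.1.1 h.1.2.1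
  refine ⟨fun h0 => ?_, fun v => ?_⟩
  · have h1 := (violation_eq_zero_iff P q x).2 h0
    have h2 := hy.total_pos h.1.2.1
    have h3 := h.total_le_violation hσ.le
    linarith
  · set L := derivWithin (fun t : ℝ => linViolation P q x (t • v)) (Set.Ioi 0) 0
    have hL : HasDerivWithinAt (fun t : ℝ => linViolation P q x (t • v)) L (Set.Ioi 0) 0 :=
      (convexOn_linViolation P q x v).hasDerivWithinAt_rightDeriv_of_mem_interior (by simp)
    refine ⟨L, ?_, ?_⟩
    -- For small `t > 0` the point `t • v` is admissible in the linear program, whose optimal value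
    -- is at least `V(x)`; so the difference quotients are nonnegative.
    · have ht := hasDerivWithinAt_iff_tendsto_slope' (by simp) |>.1 hL
      refine ge_of_tendsto ht ?_
      have hc : Tendsto (fun t : ℝ => vnorm q (fun i => (t • v) i)) (𝓝[>] 0) (𝓝 0) := by
        have h1 : Tendsto (fun t : ℝ => (n : ℝ) * ‖t • v‖) (𝓝[>] 0) (𝓝 0) := by
          have : Continuous fun t : ℝ => (n : ℝ) * ‖t • v‖ := by fun_prop
          exact (this.tendsto' 0 0 (by simp)).mono_left nhdsWithin_le_nhds
        exact squeeze_zero (fun t => vnorm_nonneg q _) (fun t => vnorm_le_card_mul_norm q _) h1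
      filter_upwards [hc.eventually (eventually_le_nhds hσ), self_mem_nhdsWithin] with t ht ht0
      have h1 := h.total_le ht
      rw [slope_def_field]
      refine div_nonneg ?_ (by simpa using le_of_lt ht0)
      simp only [zero_smul, linViolation_zero]
      linarith
    · have h1 := (hasDerivAt_violation_sub_linViolation P q hE hI v).hasDerivWithinAt
        (s := Set.Ici 0)
      simpa [Pi.add_def] using h1.add hL.Ici_of_Ioi

end Stationarity

/-! ### Quadratic forms with spectral bounds. -/

section Quadratic

variable {n : ℕ}

/-- The bilinear form `dᵀ H e`. -/
noncomputable def bilin (H : Matrix (Fin n) (Fin n) ℝ) (d e : Vec n) : ℝ :=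
  (fun i => d i) ⬝ᵥ (H *ᵥ (fun i => e i))

theorem quad_add_smul {H : Matrix (Fin n) (Fin n) ℝ} (hH : H.IsSymm) (d e : Vec n) (s : ℝ) :
    quad H (d + s • e) = quad H d + 2 * s * bilin H d e + s ^ 2 * quad H e := by
  have h1 : bilin H e d = bilin H d e := by
    unfold bilin
    rw [Matrix.dotProduct_mulVec, ← Matrix.mulVec_transpose, hH.eq, dotProduct_comm]
  have h2 : (fun i => (d + s • e) i) = (fun i => d i) + s • (fun i => e i) := by
    ext i; simp
  unfold quad
  rw [h2]
  simp only [Matrix.mulVec_add, Matrix.mulVec_smul, add_dotProduct, dotProduct_add,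
    smul_dotProduct, dotProduct_smul, smul_eq_mul]
  unfold bilin at h1
  rw [h1]
  ring_nf
  rfl

theorem quad_sub (A B : Matrix (Fin n) (Fin n) ℝ) (d : Vec n) :
    quad (A - B) d = quad A d - quad B d := by
  simp [quad, Matrix.sub_mulVec, dotProduct_sub]

theorem quad_smul_one (c : ℝ) (d : Vec n) :
    quad (c • (1 : Matrix (Fin n) (Fin n) ℝ)) d = c * ‖d‖ ^ 2 := by
  rw [EuclideanSpace.real_norm_sq_eq, Finset.mul_sum, quad, dotProduct]
  refine Finset.sum_congr rfl fun i _ => ?_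
  simp only [Matrix.smul_mulVec, Matrix.one_mulVec, Pi.smul_apply, smul_eq_mul]
  ring

theorem quad_nonneg {H : Matrix (Fin n) (Fin n) ℝ} (hH : H.PosSemidef) (d : Vec n) :
    0 ≤ quad H d := by
  simpa [quad] using hH.dotProduct_mulVec_nonneg (fun i => d i)

theorem mul_norm_sq_le_quad {H : Matrix (Fin n) (Fin n) ℝ} {μ : ℝ}
    (hH : (H - μ • (1 : Matrix (Fin n) (Fin n) ℝ)).PosSemidef) (d : Vec n) :
    μ * ‖d‖ ^ 2 ≤ quad H d := by
  have := quad_nonneg hH d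
  rw [quad_sub, quad_smul_one] at this
  linarith

theorem quad_le_mul_norm_sq {H : Matrix (Fin n) (Fin n) ℝ} {κ : ℝ}
    (hH : (κ • (1 : Matrix (Fin n) (Fin n) ℝ) - H).PosSemidef) (d : Vec n) :
    quad H d ≤ κ * ‖d‖ ^ 2 := by
  have := quad_nonneg hH d
  rw [quad_sub, quad_smul_one] at this
  linarith

/-- Cauchy–Schwarz for the semidefinite form, from the discriminant of `s ↦ quad H (d + s • e)`. A
negative `κ` forces all vectors to vanish. -/
theorem bilin_le {H : Matrix (Fin n) (Fin n) ℝ} {κ : ℝ} (hs : H.IsSymm)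
    (h0 : ∀ d, 0 ≤ quad H d) (hκ : ∀ d, quad H d ≤ κ * ‖d‖ ^ 2) (d e : Vec n) :
    bilin H d e ≤ κ * ‖d‖ * ‖e‖ := by
  have hd := hκ d
  have he := hκ e
  have hdisc : discrim (quad H e) (2 * bilin H d e) (quad H d) ≤ 0 :=
    discrim_le_zero fun s => by
      have := h0 (d + s • e)
      rw [quad_add_smul hs] at this
      linarith
  have hsq : bilin H d e ^ 2 ≤ quad H d * quad H e := by
    unfold discrim at hdisc
    linarith
  rcases le_or_gt 0 κ with h | h
  · refine le_of_abs_le (abs_le_of_sq_le_sq ?_ (by positivity))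
    refine hsq.trans ((mul_le_mul hd he (h0 e) (by positivity)).trans_eq (by ring))
  · have hz : ∀ v : Vec n, ‖v‖ = 0 := fun v => by
      have h1 := (h0 v).trans (hκ v)
      by_contra h2
      have h3 : 0 < ‖v‖ ^ 2 := by positivity
      nlinarith
    have h1 : quad H d ≤ 0 := by simpa [hz d] using hd
    have h2 : quad H e ≤ 0 := by simpa [hz e] using he
    have h3 : bilin H d e ^ 2 ≤ 0 := by
      refine hsq.trans ?_
      rw [le_antisymm h1 (h0 d), zero_mul]
    have h4 : bilin H d e = 0 := by nlinarith
    simp [h4, hz d]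

end Quadratic

/-! ### Convexity of the feasible set and first-order optimality. -/

section QuadraticProgram

variable {n mE mI : ℕ} {Ξ : Type*} {q : NormChoice}

theorem LinFeasible.combo {P : Problem n mE mI Ξ} {x d d' : Vec n} {y : Slack mE mI q}
    (h : LinFeasible P q x d y) (h' : LinFeasible P q x d' y) {s : ℝ} (hs : 0 ≤ s) (hs1 : s ≤ 1) :
    LinFeasible P q x (d + s • (d' - d)) y := by
  obtain ⟨h1, h2, h3⟩ := h
  obtain ⟨h1', h2', h3'⟩ := h'
  refine ⟨fun i => ?_, fun i => ?_, fun i => ?_⟩ <;>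
    simp only [map_add, map_smul, map_sub, PiLp.add_apply, PiLp.smul_apply, PiLp.sub_apply,
      smul_eq_mul]
  · have := mul_le_mul_of_nonneg_left (h1 i) (sub_nonneg.2 hs1)
    have := mul_le_mul_of_nonneg_left (h1' i) hs
    linarith
  · have := mul_le_mul_of_nonneg_left (h2 i) (sub_nonneg.2 hs1)
    have := mul_le_mul_of_nonneg_left (h2' i) hs
    linarith
  · have := mul_le_mul_of_nonneg_left (h3 i) (sub_nonneg.2 hs1)
    have := mul_le_mul_of_nonneg_left (h3' i) hs
    linarith

theorem QPFeasible.combo {P : Problem n mE mI Ξ} {σd : ℝ} {x d d' : Vec n} {y : Slack mE mI q}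
    (h : QPFeasible P q σd x y d) (h' : QPFeasible P q σd x y d') {s : ℝ} (hs : 0 ≤ s)
    (hs1 : s ≤ 1) : QPFeasible P q σd x y (d + s • (d' - d)) := by
  refine ⟨h.1.combo h'.1 hs hs1, ?_⟩
  have he : (fun i => (d + s • (d' - d)) i) = (1 - s) • (fun i => d i) + s • (fun i => d' i) := by
    ext i
    simp only [PiLp.add_apply, PiLp.smul_apply, PiLp.sub_apply, smul_eq_mul, Pi.add_apply,
      Pi.smul_apply]
    ring
  rw [he]
  refine (vnorm_add_le q _ _).trans ?_
  rw [vnorm_smul, vnorm_smul, abs_of_nonneg hs, abs_of_nonneg (sub_nonneg.2 hs1)]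
  have h1 := mul_le_mul_of_nonneg_left h.2 (sub_nonneg.2 hs1)
  have h2 := mul_le_mul_of_nonneg_left h'.2 hs
  linarith

/-- First-order optimality of a solution of the quadratic program. -/
theorem SolvesQP.inner_add_quad_le {P : Problem n mE mI Ξ} {σd : ℝ} {x g d d' : Vec n}
    {y : Slack mE mI q} {H : Matrix (Fin n) (Fin n) ℝ} (hH : H.IsSymm)
    (h : SolvesQP P q σd x y g H d) (h' : QPFeasible P q σd x y d') :
    inner ℝ g d + quad H d ≤ inner ℝ g d' + bilin H d d' := by
  set b := bilin H d (d' - d)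
  have hb : bilin H d d' = quad H d + b := by
    have : (fun i => (d' - d) i) = (fun i => d' i) - fun i => d i := by ext i; simp
    simp only [b, bilin, quad, this, Matrix.mulVec_sub, dotProduct_sub]
    ring
  -- Optimality against the feasible point `d + s • (d' - d)`, divided by `s`; then `s → 0`.
  have key : ∀ s ∈ Set.Ioc (0 : ℝ) 1, 0 ≤ inner ℝ g (d' - d) + b + s * (1 / 2 * quad H (d' - d)) := by
    intro s hs
    have h1 := h.2 _ (h.1.combo h' hs.1.le hs.2)
    rw [quad_add_smul hH, inner_add_right, inner_smul_right] at h1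
    refine nonneg_of_mul_nonneg_right (a := s) ?_ hs.1
    linarith
  have hlim : Tendsto (fun s : ℝ => inner ℝ g (d' - d) + b + s * (1 / 2 * quad H (d' - d)))
      (𝓝[>] 0) (𝓝 (inner ℝ g (d' - d) + b)) := by
    refine Tendsto.mono_left ?_ nhdsWithin_le_nhds
    exact Continuous.tendsto' (by fun_prop) _ _ (by simp)
  have h2 : 0 ≤ inner ℝ g (d' - d) + b := by
    refine ge_of_tendsto hlim ?_
    filter_upwards [Ioc_mem_nhdsGT (zero_lt_one' ℝ)] with s hs using key s hs
  rw [inner_sub_right] at h2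
  linarith

end QuadraticProgram

/-! ### Uniform linearization error on a compact set. -/

section UniformDifferentiability

/-- A continuously differentiable map is uniformly differentiable along a compact set. -/
theorem exists_forall_norm_sub_sub_le {E G : Type*} [NormedAddCommGroup E] [NormedSpace ℝ E]
    [NormedAddCommGroup G] [NormedSpace ℝ G] {h : E → G} (hh : ContDiff ℝ 1 h) {χ : Set E}
    (hχ : IsCompact χ) (R : ℝ) {ε : ℝ} (hε : 0 < ε) :
    ∃ a > 0, ∀ x ∈ χ, ∀ d : E, ‖d‖ ≤ R → ∀ α : ℝ, 0 ≤ α → α ≤ a →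
      ‖h (x + α • d) - (h x + α • fderiv ℝ h x d)‖ ≤ α * ε := by
  have hR : 0 < |R| + 1 := by positivity
  have hcont : Continuous (fderiv ℝ h) := hh.continuous_fderiv one_ne_zero
  -- Only one of the two points has to lie in `χ`, since trial points `x + α • d` may leave it.
  have hu := hχ.uniformContinuousAt_of_continuousAt (fderiv ℝ h)
    (fun x _ => hcont.continuousAt) (Metric.dist_mem_uniformity (div_pos hε hR))
  obtain ⟨ρ, hρ, hu⟩ := Metric.mem_uniformity_dist.1 hu
  refine ⟨ρ / 2 / (|R| + 1), by positivity, fun x hx d hd α hα hαa => ?_⟩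
  have hd' : ‖d‖ ≤ |R| + 1 := hd.trans ((le_abs_self R).trans (by linarith))
  have hαd : ‖α • d‖ ≤ ρ / 2 := by
    rw [norm_smul, Real.norm_of_nonneg hα]
    calc α * ‖d‖ ≤ ρ / 2 / (|R| + 1) * (|R| + 1) := by gcongr
      _ = ρ / 2 := by field_simp
  have hmem : x + α • d ∈ Metric.closedBall x (ρ / 2) := by
    simpa [Metric.mem_closedBall, dist_eq_norm] using hαd
  have hb : ∀ z ∈ Metric.closedBall x (ρ / 2), ‖fderiv ℝ h z - fderiv ℝ h x‖ ≤ ε / (|R| + 1) := by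
    intro z hz
    rw [← dist_eq_norm, dist_comm]
    refine le_of_lt (hu ?_ hx)
    rw [dist_comm]
    exact (Metric.mem_closedBall.1 hz).trans_lt (by linarith)
  have := (convex_closedBall x (ρ / 2)).norm_image_sub_le_of_norm_fderiv_le' (𝕜 := ℝ) (f := h)
    (fun z _ => (hh.differentiable one_ne_zero).differentiableAt) hb
    (Metric.mem_closedBall_self (by positivity)) hmem
  rw [add_sub_cancel_left, map_smul, sub_sub] at this
  refine this.trans ?_
  rw [norm_smul, Real.norm_of_nonneg hα]
  calc ε / (|R| + 1) * (α * ‖d‖) ≤ ε / (|R| + 1) * (α * (|R| + 1)) := by gcongr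
    _ = α * ε := by field_simp

end UniformDifferentiability

/-! ### Consequences of the extended MFCQ. -/

section ConstraintQualification

variable {n mE mI : ℕ} {Ξ : Type*} {q : NormChoice}

/-- A surjective derivative has right inverses that vary continuously near the point. -/
theorem exists_continuousAt_rightInverse {E G : Type*} [NormedAddCommGroup E] [NormedSpace ℝ E]
    [NormedAddCommGroup G] [NormedSpace ℝ G] [FiniteDimensional ℝ G] {X : Type*}
    [TopologicalSpace X] {J : X → E →L[ℝ] G} {x₀ : X} (hJ : ContinuousAt J x₀)
    (hs : Function.Surjective (J x₀)) :
    ∃ R : X → G →L[ℝ] E, ContinuousAt R x₀ ∧ ∀ᶠ x in 𝓝 x₀, ∀ w, J x (R x w) = w := by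
  have : CompleteSpace G := FiniteDimensional.complete ℝ G
  obtain ⟨R₀, hR₀⟩ := (J x₀).exists_rightInverse_of_surjective (LinearMap.range_eq_top.2 hs)
  have hc : ContinuousAt (fun x => (J x).comp R₀) x₀ := hJ.clm_comp continuousAt_const
  have h1 : (J x₀).comp R₀ = ((1 : (G →L[ℝ] G)ˣ) : G →L[ℝ] G) := by rw [hR₀]; rfl
  have hinv : ContinuousAt (fun x => Ring.inverse ((J x).comp R₀)) x₀ := by
    refine ContinuousAt.comp (g := Ring.inverse) ?_ hc
    rw [h1]
    exact NormedRing.inverse_continuousAt 1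
  -- `J x ∘ R₀` is the identity at `x₀`, hence invertible nearby. Where it is not a unit,
  -- `Ring.inverse` is zero, which does no harm.
  refine ⟨fun x => R₀.comp (Ring.inverse ((J x).comp R₀)), continuousAt_const.clm_comp hinv, ?_⟩
  have hunit : ∀ᶠ x in 𝓝 x₀, IsUnit ((J x).comp R₀) :=
    hc (Units.isOpen.mem_nhds (by simp [h1]))
  filter_upwards [hunit] with x hx w
  have := congrArg (fun T : G →L[ℝ] G => T w) (Ring.mul_inverse_cancel _ hx)
  simpa using this

theorem continuous_violation {P : Problem n mE mI Ξ} (hE : Continuous P.cE)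
    (hI : Continuous P.cI) (q : NormChoice) : Continuous (violation P q) := by
  refine continuous_iff_continuousAt.2 fun x₀ => ?_
  refine tendsto_iff_norm_sub_tendsto_zero.2 ?_
  have h0 : Tendsto (fun x => mE * ‖P.cE x - P.cE x₀‖ + mI * ‖P.cI x - P.cI x₀‖) (𝓝 x₀) (𝓝 0) :=
    Continuous.tendsto' (by fun_prop) _ _ (by simp)
  refine squeeze_zero (fun _ => norm_nonneg _) (fun x => ?_) h0
  have h1 := stackNorm_le_add q (P.cE x) (P.cE x₀) (P.cI x) (P.cI x₀)
  have h2 := stackNorm_le_add q (P.cE x₀) (P.cE x) (P.cI x₀) (P.cI x)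
  rw [norm_sub_rev, norm_sub_rev (P.cI x₀)] at h1
  rw [violation_eq_stackNorm, violation_eq_stackNorm]
  exact abs_le.2 ⟨by linarith, by linarith⟩

/-- Near a point where the extended MFCQ holds, there is a direction of size `O(V(x))` along which
the linearized violation decreases linearly. -/
theorem exists_direction_near {P : Problem n mE mI Ξ} (hE : ContDiff ℝ 1 P.cE)
    (hI : ContDiff ℝ 1 P.cI) (q : NormChoice) {x₀ : Vec n}
    (hs : Function.Surjective (fderiv ℝ P.cE x₀)) {u : Vec n} (hu : fderiv ℝ P.cE x₀ u = 0)
    (hu' : ∀ i, 0 ≤ P.cI x₀ i → 0 < (fderiv ℝ P.cI x₀ u) i) :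
    ∃ C > 0, ∃ ρ > 0, ∀ᶠ x in 𝓝 x₀, ∃ d : Vec n, ‖d‖ ≤ C * violation P q x ∧
      ∀ s : ℝ, 0 ≤ s → s ≤ 1 → s * violation P q x ≤ ρ →
        linViolation P q x (s • d) ≤ (1 - s) * violation P q x := by
  have hA : Continuous (fderiv ℝ P.cE) := hE.continuous_fderiv one_ne_zero
  have hB : Continuous (fderiv ℝ P.cI) := hI.continuous_fderiv one_ne_zero
  obtain ⟨R, hRc, hR⟩ := exists_continuousAt_rightInverse hA.continuousAt hs
  -- Projects `u` into the kernel of the equality Jacobian at nearby `x`, so moving along `U x`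
  -- leaves the linearized equalities unchanged.
  set U : Vec n → Vec n := fun x => u - R x (fderiv ℝ P.cE x u) with hU
  have hUc : ContinuousAt U x₀ :=
    continuousAt_const.sub (hRc.clm_apply (hA.continuousAt.clm_apply continuousAt_const))
  have hU0 : U x₀ = u := by simp [hU, hu]
  -- One margin for both kinds of inequalities: the slope along `u` if active or violated at `x₀`,
  -- the distance to the boundary if inactive.
  obtain ⟨β, hβ, hβ0⟩ : ∃ β : ℝ, (∀ i, (0 ≤ P.cI x₀ i → β < (fderiv ℝ P.cI x₀ u) i) ∧
      (P.cI x₀ i < 0 → β < -P.cI x₀ i)) ∧ 0 < β := by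
    have h1 : ∀ᶠ β : ℝ in 𝓝[>] 0, ∀ i, (0 ≤ P.cI x₀ i → β < (fderiv ℝ P.cI x₀ u) i) ∧
        (P.cI x₀ i < 0 → β < -P.cI x₀ i) := by
      refine eventually_all.2 fun i => nhdsWithin_le_nhds ?_
      rcases le_or_gt 0 (P.cI x₀ i) with h | h
      · filter_upwards [eventually_lt_nhds (hu' i h)] with β hβ
        exact ⟨fun _ => hβ, fun h' => absurd h' h.not_gt⟩
      · filter_upwards [eventually_lt_nhds (neg_pos.2 h)] with β hβ
        exact ⟨fun h' => absurd h' h.not_ge, fun _ => hβ⟩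
    exact (h1.and self_mem_nhdsWithin).exists
  set K := ‖fderiv ℝ P.cI x₀‖ + 1
  set r := ‖R x₀‖ + 1
  set w := ‖u‖ + 1
  set M := (1 + K * (r * mE)) / β
  have hK : 0 < K := by positivity
  have hr : 0 < r := by positivity
  have hw : 0 < w := by positivity
  have hM : 0 < M := by positivity
  have hMβ : M * β = 1 + K * (r * mE) := by simp only [M]; field_simp
  have hBU : ContinuousAt (fun x => fderiv ℝ P.cI x (U x)) x₀ := hB.continuousAt.clm_apply hUc
  have e1 : ∀ᶠ x in 𝓝 x₀, ∀ i, (0 ≤ P.cI x₀ i → β < (fderiv ℝ P.cI x (U x)) i) ∧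
      (P.cI x₀ i < 0 → β < -P.cI x i) := by
    refine eventually_all.2 fun i => ?_
    rcases le_or_gt 0 (P.cI x₀ i) with h | h
    · have h1 : ContinuousAt (fun x => (fderiv ℝ P.cI x (U x)) i) x₀ :=
        (PiLp.continuous_apply 2 (fun _ : Fin mI => ℝ) i).continuousAt.comp hBU
      have h2 : β < (fderiv ℝ P.cI x₀ (U x₀)) i := by rw [hU0]; exact (hβ i).1 h
      filter_upwards [h1.eventually (lt_mem_nhds h2)] with x hx
      exact ⟨fun _ => hx, fun h' => absurd h' h.not_gt⟩
    · have h1 : ContinuousAt (fun x => -P.cI x i) x₀ :=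
        ((PiLp.continuous_apply 2 (fun _ : Fin mI => ℝ) i).comp hI.continuous).neg.continuousAt
      filter_upwards [h1.eventually (lt_mem_nhds ((hβ i).2 h))] with x hx
      exact ⟨fun h' => absurd h' h.not_ge, fun _ => hx⟩
  have e2 : ∀ᶠ x in 𝓝 x₀, ‖fderiv ℝ P.cI x‖ < K :=
    hB.continuousAt.norm.eventually (gt_mem_nhds (lt_add_one _))
  have e3 : ∀ᶠ x in 𝓝 x₀, ‖R x‖ < r := hRc.norm.eventually (gt_mem_nhds (lt_add_one _))
  have e4 : ∀ᶠ x in 𝓝 x₀, ‖U x‖ < w :=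
    hUc.norm.eventually (gt_mem_nhds (by simp only [hU0]; exact lt_add_one _))
  set C := r * mE + M * w
  have hC : 0 < C := by positivity
  refine ⟨C, hC, β / (K * C), by positivity, ?_⟩
  filter_upwards [hR, e1, e2, e3, e4] with x hR e1 e2 e3 e4
  set V := violation P q x with hV
  have hV0 : 0 ≤ V := vnorm_nonneg q _
  have hcE : ‖P.cE x‖ ≤ mE * V := norm_le_card_mul_of_abs_le (abs_le_stackNorm q (P.cE x) (P.cI x))
  have hRE : ‖R x (P.cE x)‖ ≤ r * mE * V := by
    calc ‖R x (P.cE x)‖ ≤ r * (mE * V) := (R x).le_of_opNorm_le_of_le e3.le hcE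
      _ = r * mE * V := by ring
  -- The first term solves the linearized equalities. It may raise an inequality by up to `K * (r *
  -- mE * V)`; `M * β = 1 + K * (r * mE)` makes the second term offset this and lower the
  -- inequalities active or violated at `x₀` by a further `V`.
  set d : Vec n := -R x (P.cE x) - (M * V) • U x with hd
  have hdn : ‖d‖ ≤ C * V := by
    calc ‖d‖ ≤ ‖-R x (P.cE x)‖ + ‖(M * V) • U x‖ := norm_sub_le _ _
      _ ≤ r * mE * V + (M * V) * w := by
        rw [norm_neg, norm_smul, Real.norm_of_nonneg (by positivity)]
        gcongr
      _ = C * V := by simp only [C]; ring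
  have hAd : fderiv ℝ P.cE x d = -P.cE x := by simp [hd, hU, hR]
  refine ⟨d, hdn, fun s hs0 hs1 hsρ => ?_⟩
  have hBd : ∀ v : Vec n, ∀ i, |(fderiv ℝ P.cI x v) i| ≤ K * ‖v‖ := fun v i =>
    (PiLp.norm_apply_le (fderiv ℝ P.cI x v) i).trans ((fderiv ℝ P.cI x).le_of_opNorm_le e2.le v)
  refine stackNorm_le_mul q (sub_nonneg.2 hs1) (fun i => ?_) (fun i => ?_)
  · rw [map_smul, hAd]
    simp only [smul_neg, PiLp.add_apply, PiLp.neg_apply, PiLp.smul_apply, smul_eq_mul]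
    rw [show P.cE x i + -(s * P.cE x i) = (1 - s) * P.cE x i by ring, abs_mul,
      abs_of_nonneg (sub_nonneg.2 hs1)]
  · rw [map_smul]
    simp only [PiLp.add_apply, PiLp.smul_apply, smul_eq_mul]
    rcases le_or_gt 0 (P.cI x₀ i) with h | h
    · have h1 : (fderiv ℝ P.cI x d) i =
          -(fderiv ℝ P.cI x (R x (P.cE x))) i - M * V * (fderiv ℝ P.cI x (U x)) i := by
        simp [hd]
      have h2 := (neg_abs_le _).trans' (neg_le_neg ((hBd (R x (P.cE x)) i).trans
        (mul_le_mul_of_nonneg_left hRE hK.le)))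
      have h3 : M * V * β ≤ M * V * (fderiv ℝ P.cI x (U x)) i :=
        mul_le_mul_of_nonneg_left ((e1 i).1 h).le (by positivity)
      have h4 : M * V * β = V + K * (r * mE * V) := by
        rw [show M * V * β = M * β * V by ring, hMβ]; ring
      have h5 : P.cI x i ≤ V := le_stackNorm q (P.cE x) (P.cI x) i
      have h6 : P.cI x i + (fderiv ℝ P.cI x d) i ≤ 0 := by linarith
      have h7 := mul_le_mul_of_nonneg_left (le_max_left (P.cI x i) 0) (sub_nonneg.2 hs1)
      have h8 := mul_nonpos_of_nonneg_of_nonpos hs0 h6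
      linarith
    -- An inequality inactive at `x₀` lies below `-β`, and `s * V ≤ β / (K * C)` limits its increase
    -- to `β`.
    · have h1 := (e1 i).2 h
      have h2 : s * (fderiv ℝ P.cI x d) i ≤ β := by
        calc s * (fderiv ℝ P.cI x d) i ≤ s * (K * (C * V)) := by
              refine mul_le_mul_of_nonneg_left ?_ hs0
              exact (le_abs_self _).trans ((hBd d i).trans (by gcongr))
          _ = s * V * (K * C) := by ring
          _ ≤ β / (K * C) * (K * C) := by gcongr
          _ = β := by field_simp
      have h3 := mul_nonneg (sub_nonneg.2 hs1) (le_max_right (P.cI x i) 0)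
      linarith

/-- If `V(x₀) = 0`, the full MFCQ direction is short and removes the linearized violation, so `Δ_c =
V(x)` and the direction is feasible for any nonnegative slack. If `V(x₀) > 0`, a fixed fraction `s`
of it shows that `Δ_c` is bounded below, and the bounded solution `p` itself serves. -/
theorem exists_qpFeasible_near {P : Problem n mE mI Ξ} (hE : ContDiff ℝ 1 P.cE)
    (hI : ContDiff ℝ 1 P.cI) (q : NormChoice) {σp σd : ℝ} (hσp : 0 < σp) (hσ : σp ≤ σd)
    {x₀ : Vec n} (hs : Function.Surjective (fderiv ℝ P.cE x₀)) {u : Vec n}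
    (hu : fderiv ℝ P.cE x₀ u = 0) (hu' : ∀ i, 0 ≤ P.cI x₀ i → 0 < (fderiv ℝ P.cI x₀ u) i) :
    ∃ C : ℝ, ∀ᶠ x in 𝓝 x₀, ∀ p y, SolvesLP P q σp x p y →
      ∃ d, QPFeasible P q σd x y d ∧ ‖d‖ ≤ C * deltaC P q x y := by
  obtain ⟨C, hC, ρ, hρ, hev⟩ := exists_direction_near hE hI q hs hu hu'
  have hV := (continuous_violation (P := P) hE.continuous hI.continuous q).continuousAt (x := x₀)
  rcases (vnorm_nonneg q _ : 0 ≤ violation P q x₀).eq_or_lt with h0 | h0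
  · refine ⟨C, ?_⟩
    have e1 := hV.eventually (gt_mem_nhds (h0.symm.trans_lt hρ))
    have e2 := hV.eventually (gt_mem_nhds (h0.symm.trans_lt
      (show 0 < σp / (n * C + 1) by positivity)))
    filter_upwards [hev, e1, e2] with x ⟨d, hd, hlin⟩ e1 e2 p y hp
    have hlin1 := hlin 1 zero_le_one le_rfl (by linarith)
    rw [one_smul, sub_self, zero_mul] at hlin1
    have hdσ : vnorm q (fun i => d i) ≤ σp := by
      refine (vnorm_le_card_mul_norm q d).trans ?_
      have hV0 : 0 ≤ violation P q x := vnorm_nonneg q _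
      calc (n : ℝ) * ‖d‖ ≤ n * (C * violation P q x) := by gcongr
        _ ≤ violation P q x * (n * C + 1) := by linarith
        _ ≤ σp := ((lt_div_iff₀ (by positivity)).1 e2).le
    have htot := (hp.total_le hdσ).trans hlin1
    refine ⟨d, ⟨?_, hdσ.trans hσ⟩, hd.trans ?_⟩
    · have hEz : ∀ i, P.cE x i + (fderiv ℝ P.cE x d) i = 0 := fun i =>
        abs_nonpos_iff.1 ((abs_le_stackNorm q (P.cE x + fderiv ℝ P.cE x d)
          (P.cI x + fderiv ℝ P.cI x d) i).trans hlin1)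
      have hIz : ∀ i, P.cI x i + (fderiv ℝ P.cI x d) i ≤ 0 := fun i =>
        (le_stackNorm q (P.cE x + fderiv ℝ P.cE x d)
          (P.cI x + fderiv ℝ P.cI x d) i).trans hlin1
      have hyE : ∀ i, 0 ≤ Slack.eq q y i := by
        have := hp.1.2.1
        cases q with
        | linf => exact fun _ => this
        | l1 => exact this.1
      have hyI : ∀ i, 0 ≤ Slack.ineq q y i := by
        have := hp.1.2.1
        cases q with
        | linf => exact fun _ => this
        | l1 => exact this.2
      exact ⟨fun i => by linarith [hEz i, hyE i], fun i => by linarith [hEz i, hyE i],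
        fun i => (hIz i).trans (hyI i)⟩
    · unfold deltaC
      gcongr
      linarith
  · set v := violation P q x₀ with hv
    replace h0 : 0 < v := h0
    set s := min 1 (min (ρ / (2 * v)) (σp / (n * C * (2 * v) + 1)))
    have hs0 : 0 < s := by positivity
    have hs1 : s ≤ 1 := min_le_left _ _
    have hs2 : s * (2 * v) ≤ ρ :=
      (le_div_iff₀ (by positivity)).1 ((min_le_right _ _).trans (min_le_left _ _))
    have hs3 : s * (n * C * (2 * v) + 1) ≤ σp :=
      (le_div_iff₀ (by positivity)).1 ((min_le_right _ _).trans (min_le_right _ _))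
    refine ⟨n * σp / (s * (v / 2)), ?_⟩
    have e1 := hV.eventually (gt_mem_nhds (show v < 2 * v by linarith))
    have e2 := hV.eventually (lt_mem_nhds (show v / 2 < v by linarith))
    filter_upwards [hev, e1, e2] with x ⟨d, hd, hlin⟩ e1 e2 p y hp
    have hlin1 := hlin s hs0.le hs1 ((mul_le_mul_of_nonneg_left e1.le hs0.le).trans hs2)
    have hdσ : vnorm q (fun i => (s • d) i) ≤ σp := by
      refine (vnorm_le_card_mul_norm q (s • d)).trans ?_
      rw [norm_smul, Real.norm_of_nonneg hs0.le]
      calc (n : ℝ) * (s * ‖d‖) ≤ n * (s * (C * (2 * v))) := by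
            gcongr
            exact hd.trans (by gcongr)
        _ ≤ s * (n * C * (2 * v) + 1) := by linarith
        _ ≤ σp := hs3
    have htot := (hp.total_le hdσ).trans hlin1
    have hΔ : s * (v / 2) ≤ deltaC P q x y := by
      have := mul_le_mul_of_nonneg_left e2.le hs0.le
      unfold deltaC
      linarith
    refine ⟨p, ⟨hp.1.1, hp.1.2.2.trans hσ⟩, ?_⟩
    calc ‖p‖ ≤ n * σp := (norm_le_card_mul_vnorm q p).trans
          (mul_le_mul_of_nonneg_left hp.1.2.2 (by positivity))
      _ = n * σp / (s * (v / 2)) * (s * (v / 2)) := by field_simp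
      _ ≤ n * σp / (s * (v / 2)) * deltaC P q x y := by gcongr

/-- Under the extended MFCQ on a compact set, the quadratic program has a feasible point whose size
is controlled by the improvement of the linear program. -/
theorem exists_qpFeasible_norm_le {P : Problem n mE mI Ξ} (hE : ContDiff ℝ 1 P.cE)
    (hI : ContDiff ℝ 1 P.cI) (q : NormChoice) {σp σd : ℝ} (hσp : 0 < σp) (hσ : σp ≤ σd)
    {χ : Set (Vec n)} (hχ : IsCompact χ) (hM : ExtendedMFCQ P χ) :
    ∃ C : ℝ, ∀ x ∈ χ, ∀ p y, SolvesLP P q σp x p y →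
      ∃ d, QPFeasible P q σd x y d ∧ ‖d‖ ≤ C * deltaC P q x y := by
  -- Local constants are merged by taking maxima, which is valid because `Δ_c ≥ 0`.
  refine hχ.induction_on (p := fun t => ∃ C : ℝ, ∀ x ∈ t, ∀ p y, SolvesLP P q σp x p y →
      ∃ d, QPFeasible P q σd x y d ∧ ‖d‖ ≤ C * deltaC P q x y) ?_ ?_ ?_ ?_
  · exact ⟨0, fun x hx => hx.elim⟩
  · rintro s t hst ⟨C, hC⟩
    exact ⟨C, fun x hx => hC x (hst hx)⟩
  · rintro s t ⟨C, hC⟩ ⟨C', hC'⟩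
    refine ⟨max C C', fun x hx p y hp => ?_⟩
    have h0 : 0 ≤ deltaC P q x y := sub_nonneg.2 (hp.total_le_violation hσp.le)
    rcases hx with hx | hx
    · obtain ⟨d, h1, h2⟩ := hC x hx p y hp
      exact ⟨d, h1, h2.trans (mul_le_mul_of_nonneg_right (le_max_left _ _) h0)⟩
    · obtain ⟨d, h1, h2⟩ := hC' x hx p y hp
      exact ⟨d, h1, h2.trans (mul_le_mul_of_nonneg_right (le_max_right _ _) h0)⟩
  · intro x₀ hx₀
    obtain ⟨hs, u, hu, hu'⟩ := hM x₀ hx₀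
    obtain ⟨C, hC⟩ := exists_qpFeasible_near hE hI q hσp hσ hs hu hu'
    exact ⟨_, mem_nhdsWithin_of_mem_nhds hC, C, fun x hx => hx⟩

end ConstraintQualification

/-! ### Lower bound on the merit parameter and uniform step sizes. -/

section MeritParameter

variable {n mE mI : ℕ} {Ξ : Type*} {q : NormChoice}

theorem inner_gradS {P : Problem n mE mI Ξ} {S : SampleSet Ξ}
    (hF : ∀ i, Differentiable ℝ (fun z => P.F z (S.sample i))) (x d : Vec n) :
    inner ℝ (gradS P S x) d = fderiv ℝ (objS P S) x d := by
  have h : HasFDerivAt (objS P S)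
      ((1 / (S.size : ℝ)) • ∑ i, fderiv ℝ (fun z => P.F z (S.sample i)) x) x :=
    (HasFDerivAt.fun_sum fun i _ => (hF i x).hasFDerivAt).const_mul _
  rw [h.fderiv, gradS, real_inner_smul_left, sum_inner]
  simp [gradient, InnerProductSpace.toDual_symm_apply]

/-- A cut happens only when `τ` exceeds a trial value that is at least `(1 - εσ) / C`, so the result
loses at most a factor `1 - ετ` relative to that bound, however often cuts occur. -/
theorem updateTau_spec (A : Params) {gd dHd Δc τ C : ℝ} (hτ : 0 < τ) (hC : 0 < C) (hΔ : 0 ≤ Δc)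
    (h : gd + dHd ≤ C * Δc) :
    updateTau A gd dHd Δc τ ≤ τ ∧
      min τ ((1 - A.ετ) * ((1 - A.εσ) / C)) ≤ updateTau A gd dHd Δc τ ∧
      updateTau A gd dHd Δc τ * (gd + dHd) ≤ (1 - A.εσ) * Δc := by
  have h1 := sub_pos.2 A.εσ_mem.2
  have h2 := sub_pos.2 A.ετ_mem.2
  have h3 := A.ετ_mem.1
  unfold updateTau
  split_ifs with hc
  · refine ⟨le_rfl, min_le_left _ _, ?_⟩
    rcases le_or_gt (gd + dHd) 0 with h0 | h0
    · exact (mul_nonpos_of_nonneg_of_nonpos hτ.le h0).trans (by positivity)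
    · exact (le_div_iff₀ h0).1 (hc.resolve_left h0.not_ge)
  · rw [not_or, not_le, not_le] at hc
    obtain ⟨h0, hlt⟩ := hc
    set ρ := (1 - A.εσ) * Δc / (gd + dHd)
    have hρ : (1 - A.εσ) / C ≤ ρ := by
      rw [div_le_div_iff₀ hC h0, mul_assoc, mul_comm Δc]
      exact mul_le_mul_of_nonneg_left h h1.le
    have hT : 0 < (1 - A.εσ) / C := by positivity
    refine ⟨(min_le_left _ _).trans (by nlinarith), (min_le_right _ _).trans (le_min ?_ ?_), ?_⟩
    · exact mul_le_mul_of_nonneg_left (hρ.trans hlt.le) h2.le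
    · nlinarith
    · exact (le_div_iff₀ h0).1 (min_le_right _ _)

/-- The estimate that keeps the merit parameter away from zero. -/
theorem exists_inner_add_quad_le {P : Problem n mE mI Ξ} {S : SampleSet Ξ}
    (hF : ∀ i, Differentiable ℝ (fun z => P.F z (S.sample i))) (hf : ContDiff ℝ 1 (objS P S))
    (hE : ContDiff ℝ 1 P.cE) (hI : ContDiff ℝ 1 P.cI) (q : NormChoice) {σp σd : ℝ} (hσp : 0 < σp)
    (hσ : σp ≤ σd) {χ : Set (Vec n)} (hχ : IsCompact χ) (hM : ExtendedMFCQ P χ) {μ κ : ℝ}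
    (hμ : 0 < μ) (hμκ : μ ≤ κ) :
    ∃ C > 0, ∀ x ∈ χ, ∀ p y H d, SolvesLP P q σp x p y →
      SolvesQP P q σd x y (gradS P S x) H d → H.IsSymm →
      (H - μ • (1 : Matrix (Fin n) (Fin n) ℝ)).PosSemidef →
      (κ • (1 : Matrix (Fin n) (Fin n) ℝ) - H).PosSemidef →
      inner ℝ (gradS P S x) d + quad H d ≤ C * deltaC P q x y := by
  obtain ⟨C, hC⟩ := exists_qpFeasible_norm_le hE hI q hσp hσ hχ hM
  obtain ⟨G, hG⟩ := hχ.exists_bound_of_continuousOn (hf.continuous_fderiv one_ne_zero).continuousOn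
  have hκ : 0 < κ := hμ.trans_le hμκ
  have hσd : 0 < σd := hσp.trans_le hσ
  refine ⟨(|G| + κ * (n * σd)) * |C| + 1, by positivity, ?_⟩
  intro x hx p y H d hp hd hs h1 h2
  obtain ⟨d', hd', hn⟩ := hC x hx p y hp
  have hΔ : 0 ≤ deltaC P q x y := sub_nonneg.2 (hp.total_le_violation hσp.le)
  have hdn : ‖d‖ ≤ n * σd :=
    (norm_le_card_mul_vnorm q d).trans (mul_le_mul_of_nonneg_left hd.1.2 (by positivity))
  have hg : inner ℝ (gradS P S x) d' ≤ |G| * ‖d'‖ := by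
    rw [inner_gradS hF]
    exact (le_abs_self _).trans
      ((fderiv ℝ (objS P S) x).le_of_opNorm_le_of_le ((hG x hx).trans (le_abs_self G)) le_rfl)
  have hb := bilin_le hs
    (fun e => (mul_nonneg hμ.le (sq_nonneg _)).trans (mul_norm_sq_le_quad h1 e))
    (quad_le_mul_norm_sq h2) d d'
  have hn' : ‖d'‖ ≤ |C| * deltaC P q x y :=
    hn.trans (mul_le_mul_of_nonneg_right (le_abs_self C) hΔ)
  calc inner ℝ (gradS P S x) d + quad H d ≤ inner ℝ (gradS P S x) d' + bilin H d d' :=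
        hd.inner_add_quad_le hs hd'
    _ ≤ |G| * ‖d'‖ + κ * (n * σd) * ‖d'‖ := by
        refine add_le_add hg (hb.trans ?_)
        gcongr
    _ = (|G| + κ * (n * σd)) * ‖d'‖ := by ring
    _ ≤ (|G| + κ * (n * σd)) * (|C| * deltaC P q x y) := by gcongr
    _ ≤ ((|G| + κ * (n * σd)) * |C| + 1) * deltaC P q x y := by linarith

/-- Step sizes below a uniform threshold give sufficient decrease whenever the predicted reduction
is bounded away from zero. -/
theorem exists_uniform_step {P : Problem n mE mI Ξ} {S : SampleSet Ξ}
    (hF : ∀ i, Differentiable ℝ (fun z => P.F z (S.sample i))) (hf : ContDiff ℝ 1 (objS P S))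
    (hE : ContDiff ℝ 1 P.cE) (hI : ContDiff ℝ 1 P.cI) (q : NormChoice) (σd : ℝ)
    {χ : Set (Vec n)} (hχ : IsCompact χ) {τbar η θ : ℝ} (hτ : 0 < τbar) (hη : η < 1)
    (hθ : 0 < θ) :
    ∃ a > 0, a ≤ 1 ∧ ∀ x ∈ χ, ∀ (y : Slack mE mI q) d, Slack.Nonneg q y →
      QPFeasible P q σd x y d → ∀ τ, 0 ≤ τ → τ ≤ τbar → θ ≤ deltaL P q S x y d τ →
      ∀ α, 0 ≤ α → α ≤ a →
        merit P q S (x + α • d) τ ≤ merit P q S x τ - η * α * deltaL P q S x y d τ := by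
  -- The objective and constraint errors add up to at most `α (τ + mE + mI) ε`, which this choice
  -- fits into the margin `(1 - η) α Δl` left by the Armijo condition.
  set ε := (1 - η) * θ / (τbar + mE + mI) with hεdef
  have hη' : 0 < 1 - η := sub_pos.2 hη
  have hε : 0 < ε := by positivity
  obtain ⟨a₁, ha₁, h₁⟩ := exists_forall_norm_sub_sub_le hf hχ (n * σd) hε
  obtain ⟨a₂, ha₂, h₂⟩ := exists_forall_norm_sub_sub_le hE hχ (n * σd) hε
  obtain ⟨a₃, ha₃, h₃⟩ := exists_forall_norm_sub_sub_le hI hχ (n * σd) hε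
  refine ⟨min 1 (min a₁ (min a₂ a₃)), by positivity, min_le_left _ _, ?_⟩
  intro x hx y d hy hd τ hτ0 hτ1 hΔ α hα0 hα
  have hα1 : α ≤ 1 := hα.trans (min_le_left _ _)
  have hα' := hα.trans (min_le_right _ _)
  have hα'' := hα'.trans (min_le_right _ _)
  have hdn : ‖d‖ ≤ n * σd :=
    (norm_le_card_mul_vnorm q d).trans (mul_le_mul_of_nonneg_left hd.2 (by positivity))
  have k₁ := h₁ x hx d hdn α hα0 (hα'.trans (min_le_left _ _))
  have k₂ := h₂ x hx d hdn α hα0 (hα''.trans (min_le_left _ _))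
  have k₃ := h₃ x hx d hdn α hα0 (hα''.trans (min_le_right _ _))
  have l₁ : τ * objS P S (x + α • d) ≤
      τ * (objS P S x + α * inner ℝ (gradS P S x) d + α * ε) := by
    refine mul_le_mul_of_nonneg_left ?_ hτ0
    rw [inner_gradS hF]
    have := (le_abs_self _).trans k₁
    rw [smul_eq_mul] at this
    linarith
  have l₂ : violation P q (x + α • d) ≤
      linViolation P q x (α • d) + (mE * (α * ε) + mI * (α * ε)) := by
    rw [← map_smul] at k₂ k₃
    refine (stackNorm_le_add q (P.cE x + fderiv ℝ P.cE x (α • d)) _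
      (P.cI x + fderiv ℝ P.cI x (α • d)) _).trans ?_
    unfold linViolation
    gcongr
  have l₃ : linViolation P q x (α • d) ≤ (1 - α) * violation P q x + α * Slack.total q y := by
    have := linViolation_combo_le P q x 0 d (sub_nonneg.2 hα1) hα0 (by ring)
    rw [smul_zero, zero_add, linViolation_zero] at this
    refine this.trans ?_
    gcongr
    exact linViolation_le_total P q hd.1 hy
  have l₄ : α * ((τ + mE + mI) * ε) ≤ α * ((1 - η) * deltaL P q S x y d τ) := by
    refine mul_le_mul_of_nonneg_left ?_ hα0
    calc (τ + mE + mI) * ε ≤ (τbar + mE + mI) * ε := by gcongr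
      _ = (1 - η) * θ := by rw [hεdef]; field_simp
      _ ≤ (1 - η) * deltaL P q S x y d τ := by gcongr
  unfold merit
  unfold deltaL deltaC at l₄ ⊢
  linarith

end MeritParameter

/-! ### Convergence of the inner loop. -/

section InnerLoopConvergence

variable {n mE mI : ℕ} {Ξ : Type*} {q : NormChoice}

/-- Alternative for one inner loop: it reaches an infeasible stationary point, or its test is
satisfied, or it runs forever and its directions tend to zero. -/
theorem IsInnerLoop.alternative {P : Problem n mE mI Ξ} {A : Params} {S : SampleSet Ξ}
    (hF : ∀ i, Differentiable ℝ (fun z => P.F z (S.sample i))) (hf : ContDiff ℝ 1 (objS P S))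
    (hE : ContDiff ℝ 1 P.cE) (hI : ContDiff ℝ 1 P.cI) {χ : Set (Vec n)} (hχ : IsCompact χ)
    (hM : ExtendedMFCQ P χ) {μ κ : ℝ} (hμ : 0 < μ) (hμκ : μ ≤ κ) {T : ℕ → Prop} {x₀ : Vec n}
    {D : InnerData n mE mI q} (hD : IsInnerLoop P A S T x₀ D)
    (hH : HessianBounds P A S T μ κ D) (hmem : ∀ j, Reached P A S T D j → D.x j ∈ χ) :
    (∃ N, Reached P A S T D N ∧ InfStop D N ∧ IsInfeasibleStationary P q (D.x N)) ∨
      (∃ N, Reached P A S T D N ∧ ¬ InfStop D N ∧ T N) ∨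
      ((∀ j, Reached P A S T D j) ∧ Tendsto D.d atTop (𝓝 0)) := by
  rw [or_iff_not_imp_left]
  intro hinf
  rw [or_iff_not_imp_left]
  intro htest
  have hninf : ∀ j, Reached P A S T D j → ¬ InfStop D j := fun j hj h =>
    hinf ⟨j, hj, h, isInfeasibleStationary_of_solvesLP A.σp_pos
      (hE.differentiable one_ne_zero _) (hI.differentiable one_ne_zero _) (hD.solvesLP j hj)
      (norm_eq_zero.1 h.1) h.2⟩
  have hntest : ∀ j, Reached P A S T D j → ¬ T j := fun j hj h =>
    htest ⟨j, hj, hninf j hj, h⟩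
  obtain ⟨C, hC, hbound⟩ := exists_inner_add_quad_le hF hf hE hI q A.σp_pos A.σp_lt_σd.le hχ hM
    hμ hμκ
  have hεσ := sub_pos.2 A.εσ_mem.2
  have hετ := sub_pos.2 A.ετ_mem.2
  have hτb := A.τbar_pos
  have hεα := A.εα_mem.1
  have hη := A.η_mem.1
  set τm := min A.τbar ((1 - A.ετ) * ((1 - A.εσ) / C))
  have hτm : 0 < τm := by positivity
  have hτstep : ∀ j, Reached P A S T D j → τm ≤ D.tau j → D.tau (j + 1) ≤ D.tau j ∧
      τm ≤ D.tau (j + 1) ∧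
      τm * μ * ‖D.d j‖ ^ 2 ≤ deltaL P q S (D.x j) (D.y j) (D.d j) (D.tau (j + 1)) := by
    intro j hj hτj
    have hLP := hD.solvesLP j hj
    have hQP := hD.solvesQP j hj (hninf j hj)
    obtain ⟨hs, h1, h2⟩ := hH j hj (hninf j hj)
    have hΔ : 0 ≤ deltaC P q (D.x j) (D.y j) :=
      sub_nonneg.2 (hLP.total_le_violation A.σp_pos.le)
    obtain ⟨t1, t2, t3⟩ := updateTau_spec A (hτm.trans_le hτj) hC hΔ
      (hbound _ (hmem j hj) _ _ _ _ hLP hQP hs h1 h2)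
    rw [← hD.tau_succ j hj (hninf j hj) (hntest j hj)] at t1 t2 t3
    have t4 : τm ≤ D.tau (j + 1) := (le_min hτj (min_le_right _ _)).trans t2
    refine ⟨t1, t4, ?_⟩
    -- The update rule gives `Δl ≥ τ dᵀHd + εσ Δ_c`, and the last term is nonnegative.
    have h3 : τm * (μ * ‖D.d j‖ ^ 2) ≤ D.tau (j + 1) * quad (D.H j) (D.d j) :=
      mul_le_mul t4 (mul_norm_sq_le_quad h1 _) (by positivity) (hτm.le.trans t4)
    have h4 := mul_nonneg A.εσ_mem.1.le hΔ
    unfold deltaL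
    linarith
  have hτ : ∀ j, Reached P A S T D j → τm ≤ D.tau j ∧ D.tau j ≤ A.τbar := by
    intro j hj
    induction hj with
    | zero => exact ⟨hD.tau_zero ▸ min_le_left _ _, hD.tau_zero.le⟩
    | succ j hj _ _ _ ih =>
      obtain ⟨t1, t2, -⟩ := hτstep j hj ih.1
      exact ⟨t2, t1.trans ih.2⟩
  have hstep : ∀ θ > 0, ∃ a > 0, a ≤ 1 ∧ ∀ j, Reached P A S T D j →
      θ ≤ deltaL P q S (D.x j) (D.y j) (D.d j) (D.tau (j + 1)) → ∀ i, A.εα ^ i ≤ a →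
      Armijo P A S D j i := by
    intro θ hθ
    obtain ⟨a, ha, ha1, h⟩ := exists_uniform_step hF hf hE hI q A.σd hχ hτb A.η_mem.2 hθ
    refine ⟨a, ha, ha1, fun j hj hΔ i hi => ?_⟩
    obtain ⟨t1, t2, -⟩ := hτstep j hj (hτ j hj).1
    exact h _ (hmem j hj) _ _ (hD.solvesLP j hj).1.2.1 (hD.solvesQP j hj (hninf j hj)).1 _
      (hτm.le.trans t2) (t1.trans (hτ j hj).2) hΔ _ (by positivity) hi
  have harm : ∀ j, Reached P A S T D j → ∃ i, Armijo P A S D j i := by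
    intro j hj
    -- For `d = 0` feasibility forces `Δ_c ≤ 0`, so the unit step passes trivially; otherwise the
    -- predicted reduction is positive.
    by_cases hd : D.d j = 0
    · refine ⟨0, ?_⟩
      have hQ := (hD.solvesQP j hj (hninf j hj)).1.1
      rw [hd] at hQ
      have h1 := linViolation_le_total P q hQ (hD.solvesLP j hj).1.2.1
      rw [linViolation_zero] at h1
      have h2 : deltaC P q (D.x j) (D.y j) ≤ 0 := sub_nonpos.2 h1
      have h3 := mul_nonpos_of_nonneg_of_nonpos hη.le h2
      simp only [Armijo, hd, deltaL, smul_zero, add_zero, inner_zero_right, mul_zero, zero_add,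
        pow_zero, mul_one]
      linarith
    · have hpos : 0 < ‖D.d j‖ := norm_pos_iff.2 hd
      obtain ⟨a, ha, -, h⟩ := hstep (τm * μ * ‖D.d j‖ ^ 2) (by positivity)
      obtain ⟨i, hi⟩ := exists_pow_lt_of_lt_one ha A.εα_mem.2
      exact ⟨i, h j hj (hτstep j hj (hτ j hj).1).2.2 i hi.le⟩
  have hall : ∀ j, Reached P A S T D j := fun j => by
    induction j with
    | zero => exact .zero
    | succ j ih => exact .succ j ih (hninf j ih) (hntest j ih) (harm j ih)
  refine ⟨hall, ?_⟩
  obtain ⟨m, hm⟩ := hχ.bddBelow_image hf.continuous.continuousOn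
  have hm' : ∀ j, m ≤ objS P S (D.x j) := fun j => hm ⟨_, hmem j (hall j), rfl⟩
  -- Subtracting the lower bound `m` makes the factor of `τ` nonnegative, so decreasing `τ` cannot
  -- raise `Φ` although the merit function changes with it.
  set Φ : ℕ → ℝ := fun j => D.tau j * (objS P S (D.x j) - m) + violation P q (D.x j) with hΦ
  have hleast : ∀ j, ∃ i, IsLeast {i | Armijo P A S D j i} i := fun j => by
    classical exact ⟨Nat.find (harm j (hall j)), Nat.find_spec (harm j (hall j)),
      fun i hi => Nat.find_min' _ hi⟩
  choose i hi using hleast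
  have hdesc : ∀ j, A.η * A.εα ^ i j *
      deltaL P q S (D.x j) (D.y j) (D.d j) (D.tau (j + 1)) ≤ Φ j - Φ (j + 1) := by
    intro j
    have h1 : Armijo P A S D j (i j) := (hi j).1
    unfold Armijo at h1
    rw [← hD.x_succ j (hall j) (hninf j (hall j)) (hntest j (hall j)) (i j) (hi j)] at h1
    have h2 := mul_le_mul_of_nonneg_right (hτstep j (hall j) (hτ j (hall j)).1).1
      (sub_nonneg.2 (hm' j))
    simp only [hΦ]
    unfold merit at h1
    linarith
  have hΔ0 : ∀ j, 0 ≤ deltaL P q S (D.x j) (D.y j) (D.d j) (D.tau (j + 1)) := fun j =>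
    (by positivity : 0 ≤ τm * μ * ‖D.d j‖ ^ 2).trans (hτstep j (hall j) (hτ j (hall j)).1).2.2
  have hanti : Antitone Φ := antitone_nat_of_succ_le fun j => by
    have h1 := mul_nonneg (by positivity : 0 ≤ A.η * A.εα ^ i j) (hΔ0 j)
    have h2 := hdesc j
    linarith
  have hbdd : BddBelow (Set.range Φ) := by
    refine ⟨0, ?_⟩
    rintro _ ⟨j, rfl⟩
    exact add_nonneg (mul_nonneg (hτm.le.trans (hτ j (hall j)).1) (sub_nonneg.2 (hm' j)))
      (vnorm_nonneg q _)
  have hlim : Tendsto (fun j => Φ j - Φ (j + 1)) atTop (𝓝 0) := by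
    have h1 := tendsto_atTop_ciInf hanti hbdd
    simpa using h1.sub (h1.comp (tendsto_add_atTop_nat 1))
  rw [tendsto_zero_iff_norm_tendsto_zero]
  refine (Metric.tendsto_atTop.2 fun δ hδ => ?_)
  obtain ⟨a, ha, ha1, h⟩ := hstep (τm * μ * δ ^ 2) (by positivity)
  have hev := hlim.eventually (gt_mem_nhds
    (show 0 < A.η * (A.εα * a) * (τm * μ * δ ^ 2) by positivity))
  obtain ⟨N, hN⟩ := eventually_atTop.1 hev
  refine ⟨N, fun j hj => ?_⟩
  rw [dist_zero_right, norm_norm]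
  by_contra! hd
  have hθ : τm * μ * δ ^ 2 ≤ deltaL P q S (D.x j) (D.y j) (D.d j) (D.tau (j + 1)) :=
    le_trans (by gcongr) (hτstep j (hall j) (hτ j (hall j)).1).2.2
  -- Either the unit step was accepted, or the preceding trial step was rejected and hence exceeds
  -- `a`.
  have hα : A.εα * a ≤ A.εα ^ i j := by
    rcases hij : i j with _ | l
    · rw [pow_zero]
      exact mul_le_one₀ A.εα_mem.2.le ha.le ha1
    · rw [pow_succ']
      refine mul_le_mul_of_nonneg_left ?_ hεα.le
      by_contra! hlt
      have := (hi j).2 (h j (hall j) hθ l hlt.le)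
      omega
  have h1 : A.η * (A.εα * a) * (τm * μ * δ ^ 2) ≤
      A.η * A.εα ^ i j * deltaL P q S (D.x j) (D.y j) (D.d j) (D.tau (j + 1)) := by
    gcongr
  exact absurd (hN j hj) (not_lt.2 (h1.trans (hdesc j)))

end InnerLoopConvergence

end RASQP

/-! ### The alternative with the empty test and with the direction-norm test. -/

theorem mainTheorem7 {n mE mI : ℕ} {Ξ : Type*} (q : RASQP.NormChoice)
    (P : RASQP.Problem n mE mI Ξ) (A : RASQP.Params) (S : ℕ → RASQP.SampleSet Ξ)
    (x₀ : RASQP.Vec n) (D : ℕ → RASQP.InnerData n mE mI q) (hrun : RASQP.IsRun P A S x₀ D)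
    (χ : Set (RASQP.Vec n)) (hχ_closed : IsClosed χ) (hχ_bdd : Bornology.IsBounded χ)
    (hχ_convex : Convex ℝ χ)
    (hχ_mem : ∀ k, RASQP.OuterReached P A S D k →
      ∀ j, RASQP.Reached P A (S k) (RASQP.DirTest A k (D k)) (D k) j → (D k).x j ∈ χ)
    (hsmooth : RASQP.Smooth P S χ)
    (μH κH : ℝ) (hμ : 0 < μH) (hμκ : μH ≤ κH)
    (hH : ∀ k, RASQP.OuterReached P A S D k →
      RASQP.HessianBounds P A (S k) (RASQP.DirTest A k (D k)) μH κH (D k))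
    (hMFCQ : RASQP.ExtendedMFCQ P χ) :
    ∀ k, RASQP.OuterReached P A S D k →
      -- the inner loop with the direction-norm test left out:
      -- it stops at an infeasible stationary point, or it runs forever and `d_{k,j} → 0`
      (∀ D' : RASQP.InnerData n mE mI q,
        RASQP.IsInnerLoop P A (S k) (fun _ => False) ((D k).x 0) D' →
        RASQP.HessianBounds P A (S k) (fun _ => False) μH κH D' →
        (∀ j, RASQP.Reached P A (S k) (fun _ => False) D' j → D'.x j ∈ χ) →
        (∃ N, RASQP.Reached P A (S k) (fun _ => False) D' N ∧ RASQP.InfStop D' N ∧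
            RASQP.IsInfeasibleStationary P q (D'.x N)) ∨
          ((∀ j, RASQP.Reached P A (S k) (fun _ => False) D' j) ∧
            Tendsto D'.d atTop (𝓝 0))) ∧
      -- the inner loop of the algorithm is finite
      (0 < A.γ k ∨ 0 < A.ε k →
        ∃ N, (RASQP.Reached P A (S k) (RASQP.DirTest A k (D k)) (D k) N ∧
            RASQP.InfStop (D k) N ∧ RASQP.IsInfeasibleStationary P q ((D k).x N)) ∨
          RASQP.EndsByTest P A (S k) k (D k) N) := by
  intro k hk
  have hχ : IsCompact χ := Metric.isCompact_of_isClosed_isBounded hχ_closed hχ_bdd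
  refine ⟨fun D' hD' hH' hmem' => ?_, fun hpos => ?_⟩
  · rcases hD'.alternative (hsmooth.differentiable_F k) (hsmooth.contDiff_objS k)
      hsmooth.contDiff_cE hsmooth.contDiff_cI hχ hMFCQ hμ hμκ hH' hmem' with h | ⟨N, -, -, h⟩ | h
    · exact Or.inl h
    · exact h.elim
    · exact Or.inr h
  · rcases (hrun.inner_loop k hk).alternative (hsmooth.differentiable_F k)
      (hsmooth.contDiff_objS k) hsmooth.contDiff_cE hsmooth.contDiff_cI hχ hMFCQ hμ hμκ (hH k hk)
      (hχ_mem k hk) with ⟨N, h⟩ | ⟨N, h⟩ | ⟨hall, hlim⟩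
    · exact ⟨N, Or.inl h⟩
    · exact ⟨N, Or.inr h⟩
    · have hnorm : Tendsto (fun j => ‖(D k).d j‖) atTop (𝓝 0) := by simpa using hlim.norm
      have hnot : ∀ j, ¬ RASQP.DirTest A k (D k) j := fun j => by
        cases hall (j + 1) with
        | succ _ _ _ h _ => exact h
      have hγ := A.γ_nonneg k
      have hε := A.ε_nonneg k
      -- The threshold is positive even if only `γ k > 0`: with `d 0 = 0` the test would already
      -- hold at `j = 0`. So `d_j → 0` eventually meets the test.
      have hbound : 0 < A.γ k * ‖(D k).d 0‖ + A.ε k := by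
        rcases hpos with h | h
        · have hd : 0 < ‖(D k).d 0‖ := by
            by_contra! h0
            refine hnot 0 (h0.trans ?_)
            positivity
          positivity
        · positivity
      obtain ⟨j, hj⟩ := (hnorm.eventually (gt_mem_nhds hbound)).exists
      exact absurd hj.le (hnot j)
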